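/- All structures are relational. For structures $A, C$ in the same language, a copy of $A$ in $C$ is a substructure of $C$ isomorphic to $A$. A class $\mathcal K$ of finite structures has the Ramsey property if for all $k\in\mathbb N$ and $A,B\in\mathcal K$ there is $C\in\mathcal K$ such that for every colouring of the copies of $A$ in $C$ with $k$ colours there is a copy $B'$ of $B$ in $C$ such that all copies of $A$ contained in $B'$ have the same colour. $\mathrm{Age}(M)$ is the class of finite structures that embed in $M$. A tournament is a directed graph with exactly one edge between any two distinct vertices; a structure is homogeneous if every isomorphism between finite substructures extends to an automorphism. Blow-ups. Let $T^*$ be an expansion of a tournament $T=(T,E)$ by a linear order $<^*$ and further relations. Fix a linear order $\prec$ on $\mathbb N$ with $(\mathbb N,\prec)\cong(\mathbb Q,<)$. The structure $T[I_\omega]^*$, in the language of $T^*$, has universe $T\times\mathbb N$; $<$ is interpreted as the lexicographic product of $<^*$ and $\prec$ ($(x,i)<(y,j)$ iff $x<^*y$, or $x=y$ and $i\prec j$), and every other symbol $R$ (including $E$) by: $R((x_1,i_1),\dots,(x_m,i_m))$ iff $R(x_1,\dots,x_m)$ holds in $T^*$. The standard expansions $T^*$ of the infinite homogeneous tournaments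 are, up to isomorphism: - $\mathbb Q^*$: the rationals, with both $E$ and $<^*$ equal to the usual order. - $\mathbf S(2)^*$: the points $e^{iq}$, $q\in\mathbb Q$, of the unit circle, with $E(x,y)$ iff the angle from $x$ to $y$ lies in $(0,\pi)$, two unary predicates for the left half ($\mathrm{Re}<0$) and the right half ($\mathrm{Re}>0$), and the linear order $<^*$ obtained from $E$ by reversing the edges between points in different halves. - $T^{\omega *}$: the Fraïssé limit of the class of all finite linearly ordered tournaments. Theorem. 1. Let $T$ be a countably infinite homogeneous tournament and let $T^*$ be an expansion of $T$ that is one of the standard expansions above. Then $\mathrm{Age}(T[I_\omega]^*)$ has the Ramsey property. 2. More generally, if $T^*$ is any expansion of a tournament by a linear order and further relations such that $\mathrm{Age}(T^*)$ has the Ramsey property, then $\mathrm{Age}(T[I_\omega]^*)$ has the Ramsey property. 3. Let $C_3[I_\omega]^*$ be the structure with universe $\{0,1,2\}\times\mathbb N$, edges from $(i,a)$ to $(j,b)$ iff $j\equiv i+1 \pmod 3$, unary predicates $P_0,P_1,P_2$ with $P_i=\{(i,a):a\in\mathbb N\}$, and a linear order $<^*$ that is dense on each $P_i$ and satisfies $P_0<^*P_1<^*P_2$.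 Then $\mathrm{Age}(C_3[I_\omega]^*)$ has the Ramsey property. -/

import Mathlib

open FirstOrder FirstOrder.Language FirstOrder.Language.Structure CategoryTheory

universe u v w

namespace RamseyBlowUp

/-! ### Copies, arrows and the Ramsey property -/

section Ramsey

variable {L : FirstOrder.Language.{u, v}}

/-- The set of all copies of `A` in `C`: the substructures of `C` isomorphic to `A`. -/
def Copies (C A : Type*) [L.Structure C] [L.Structure A] : Set (L.Substructure C) :=
  {S | Nonempty (A ≃[L] S)}

/-- `C ⟶ (B)^A_k`: for every colouring of the copies of `A` in `C` with `k` colours there is a copy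
`B'` of `B` in `C` such that all copies of `A` lying inside `B'` have the same colour. -/
def Arrow (L : FirstOrder.Language.{u, v}) (C B A : Type*) [L.Structure C] [L.Structure B] [L.Structure A]
    (k : ℕ) : Prop :=
  ∀ c : (Copies (L := L) C A) → Fin k, ∃ B' ∈ Copies (L := L) C B,
    ∀ A₁ A₂ : Copies (L := L) C A, A₁.1 ≤ B' → A₂.1 ≤ B' → c A₁ = c A₂

/-- The Ramsey property of a class of structures. -/
def RamseyProperty (K : Set (Bundled.{w} L.Structure)) : Prop :=
  ∀ k : ℕ, ∀ A ∈ K, ∀ B ∈ K, ∃ C ∈ K, Arrow L C B A k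

end Ramsey

/-! ### Languages -/

/-- The relation symbols of the language of directed graphs: one binary symbol. -/
inductive DigraphRel : ℕ → Type
  | edge : DigraphRel 2

/-- The language of directed graphs. -/
def digraphLang : FirstOrder.Language.{0, 0} := ⟨fun _ => Empty, DigraphRel⟩

instance : digraphLang.IsRelational := fun _ => inferInstanceAs (IsEmpty Empty)

/-- The binary symbols `E` (edge) and `<`, together with further relation symbols `R n` of
arity `n`, for every `n`. -/
inductive StarRel (R : ℕ → Type u) : ℕ → Type u
  | edge : StarRel R 2
  | lt : StarRel R 2
  | other {n : ℕ} (r : R n) : StarRel R n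

/-- The relational language with symbols `E`, `<` and the further relation symbols `R`. -/
def starLang (R : ℕ → Type u) : FirstOrder.Language.{0, u} := ⟨fun _ => Empty, StarRel R⟩

instance (R : ℕ → Type u) : (starLang R).IsRelational :=
  fun _ => inferInstanceAs (IsEmpty Empty)

/-- The inclusion of the language of directed graphs. -/
def digraphIncl (R : ℕ → Type u) : digraphLang →ᴸ starLang R where
  onFunction := fun _ f => f.elim
  onRelation := fun | _, DigraphRel.edge => StarRel.edge

/-- No further relation symbols. -/
def NoSymbol : ℕ → Type := fun _ => Empty

/-- A family of unary relation symbols indexed by `ι`. -/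
inductive UnarySymbol (ι : Type) : ℕ → Type
  | mk (i : ι) : UnarySymbol ι 1

/-- The edge relation of a structure. -/
def edge (R : ℕ → Type u) {T : Type v} [(starLang R).Structure T] (x y : T) : Prop :=
  RelMap (L := starLang R) (StarRel.edge : StarRel R 2) ![x, y]

/-- The interpretation of `<` in a structure. -/
def less (R : ℕ → Type u) {T : Type v} [(starLang R).Structure T] (x y : T) : Prop :=
  RelMap (L := starLang R) (StarRel.lt : StarRel R 2) ![x, y]

/-- The edge relation of a structure in the language of directed graphs. -/
def digraphEdge {T : Type v} [digraphLang.Structure T] (x y : T) : Prop :=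
  RelMap (L := digraphLang) DigraphRel.edge ![x, y]

/-- A tournament: an asymmetric relation such that distinct points are joined by an edge. -/
def IsTournament {T : Type v} (E : T → T → Prop) : Prop :=
  (∀ x y, E x y → ¬ E y x) ∧ ∀ x y, x ≠ y → E x y ∨ E y x

/-! ### The blow-up `T[I_ω]*` -/

/-- The universe `T × ℕ` of `T[I_ω]*`; the relation `prec` on `ℕ` orders the fibres. -/
def BlowUp (T : Type v) (_prec : ℕ → ℕ → Prop) : Type v := T × ℕ

/-- The structure `T[I_ω]*` built from `T*`: the symbol `<` is the lexicographic product of `<` on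
`T*` with `prec`, every other symbol is read off the first coordinates. -/
instance blowUpStructure (R : ℕ → Type u) (T : Type v) [(starLang R).Structure T]
    (prec : ℕ → ℕ → Prop) : (starLang R).Structure (BlowUp T prec) where
  funMap := fun f => f.elim
  RelMap := fun
    | StarRel.edge, p => edge R (p 0).1 (p 1).1
    | StarRel.lt, p => less R (p 0).1 (p 1).1 ∨ ((p 0).1 = (p 1).1 ∧ prec (p 0).2 (p 1).2)
    | StarRel.other r, p =>
        RelMap (L := starLang R) (M := T) (StarRel.other r : StarRel R _) fun i => (p i).1

/-! ### The expansions `T*` of the infinite homogeneous tournaments -/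

/-- `ℚ*`: the rationals, where `E` and `<` are both the usual order. -/
instance ratStar : (starLang NoSymbol).Structure ℚ where
  funMap := fun f => f.elim
  RelMap := fun
    | StarRel.edge, p => p 0 < p 1
    | StarRel.lt, p => p 0 < p 1

/-- The points at a rational angle on the unit circle. -/
def S2 : Type := {z : Circle // ∃ q : ℚ, z = Circle.exp (q : ℝ)}

namespace S2

/-- There is an edge from `z` to `w` iff the angle from `z` to `w` lies in `(0, π)`. -/
def Edge (z w : S2) : Prop := ∃ θ ∈ Set.Ioo (0 : ℝ) Real.pi, w.1 = Circle.exp θ * z.1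

/-- The left half (`i = 0`) and the right half (`i = 1`) of the circle. -/
def Half : Fin 2 → S2 → Prop
  | 0, z => ((z.1 : ℂ)).re < 0
  | 1, z => 0 < ((z.1 : ℂ)).re

/-- The linear order obtained from the edge relation by reversing the edges between points in
different halves. -/
def Less (z w : S2) : Prop :=
  ((∃ i, Half i z ∧ Half i w) ∧ Edge z w) ∨ ((¬ ∃ i, Half i z ∧ Half i w) ∧ Edge w z)

end S2

/-- `S(2)*`: the dense local order with two unary predicates for the halves and its linear order. -/
instance s2Star : (starLang (UnarySymbol (Fin 2))).Structure S2 where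
  funMap := fun f => f.elim
  RelMap := fun
    | StarRel.edge, p => S2.Edge (p 0) (p 1)
    | StarRel.lt, p => S2.Less (p 0) (p 1)
    | StarRel.other (UnarySymbol.mk i), p => S2.Half i (p 0)

/-- The class of finite linearly ordered tournaments. -/
def orderedTournaments : Set (Bundled.{v} (starLang NoSymbol).Structure) :=
  {M | Finite M ∧ IsTournament (edge NoSymbol (T := M)) ∧
    IsStrictTotalOrder M (less NoSymbol (T := M))}

instance (R : ℕ → Type u) : Countable (Σ l, (starLang R).Functions l) :=
  inferInstanceAs (Countable (Σ _ : ℕ, Empty))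

/-- The standard expansions of the infinite homogeneous tournaments: `ℚ*`, `S(2)*`, and the Fraïssé
limit `T^ω*` of the finite linearly ordered tournaments, up to isomorphism. -/
inductive IsStandardExpansion :
    (R : ℕ → Type) → (T : Type v) → (starLang R).Structure T → Prop
  | rat (T : Type v) [s : (starLang NoSymbol).Structure T]
      (h : Nonempty (T ≃[starLang NoSymbol] ℚ)) : IsStandardExpansion NoSymbol T s
  | denseLocal (T : Type v) [s : (starLang (UnarySymbol (Fin 2))).Structure T]
      (h : Nonempty (T ≃[starLang (UnarySymbol (Fin 2))] S2)) :
      IsStandardExpansion (UnarySymbol (Fin 2)) T s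
  | generic (T : Type v) [s : (starLang NoSymbol).Structure T] [Countable T]
      (h : IsFraisseLimit orderedTournaments T) : IsStandardExpansion NoSymbol T s

/-! ### The blow-up `C₃[I_ω]*` of the `3`-cycle -/

/-- The universe of `C₃[I_ω]*`, which carries the linear order `lt`. -/
def C3BlowUp (_lt : Fin 3 × ℕ → Fin 3 × ℕ → Prop) : Type := Fin 3 × ℕ

/-- `C₃[I_ω]*`: there is an edge from `(i, a)` to `(j, b)` iff `i → j` in the cycle `0 → 1 → 2 → 0`,
`<` is the given order, and the three fibres are named by unary predicates. -/
instance c3BlowUpStructure (lt : Fin 3 × ℕ → Fin 3 × ℕ → Prop) :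
    (starLang (UnarySymbol (Fin 3))).Structure (C3BlowUp lt) where
  funMap := fun f => f.elim
  RelMap := fun
    | StarRel.edge, p => (p 1).1 = (p 0).1 + 1
    | StarRel.lt, p => lt (p 0) (p 1)
    | StarRel.other (UnarySymbol.mk i), p => (p 0).1 = i

end RamseyBlowUp

namespace RamseyBlowUp

/-! ### Ramsey's theorem for finite linear orders -/

/-! By compactness of the space of colourings, the age of `M` is Ramsey once every finite colouring
of the embeddings of `A` in `M` is constant on the embeddings through some copy of `B`
(`ramseyProperty_age_of_embeddings`). So one may work inside the infinite structure and colour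
embeddings.

The transfer (`ramseyProperty_blowUp`) combines two Ramsey theorems. Two points of a blow-up of a
tournament lie in one fibre iff no edge joins them, so an embedding between finite substructures
induces an embedding of their projections to `T`. Conversely, an embedding of the projection of `A`
in `T` together with an increasing map of `A` into `ℕ` yields an embedding of `A` in the blow-up.
Ramsey's theorem for linear orders, with functions on the embeddings of projections as colours,
removes the dependence on the increasing map; the Ramsey property of `Age(T*)` then handles the
projections.

It remains to treat the bases. `ℚ*`, `S(2)*` and the blown-up 3-cycle are linear orders whose points
carry a label visible to the unary predicates, all relations being determined by order and labels;
Ramsey's theorem suffices (`ramseyProperty_age_of_label`). For the generic ordered tournament,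
Ramsey's theorem is combined with the partite construction: the Hales–Jewett theorem makes the
copies of `A` over one fixed set of parts monochromatic, iteration makes the colour depend only on
the parts, and Ramsey's theorem on the indices of the parts finishes. -/

theorem _root_.Ultrafilter.exists_eventually_eq {α κ : Type*} [Finite κ] (U : Ultrafilter α)
    (f : α → κ) : ∃ k, ∀ᶠ x in (U : Filter α), f x = k := by
  obtain ⟨k, hk⟩ := (U.map f).eq_pure_of_finite
  refine ⟨k, ?_⟩
  have : {k} ∈ U.map f := by rw [hk]; exact Set.mem_singleton k
  exact this

/-- **Ramsey's theorem**: every finite colouring of the finite subsets of `ℕ` has arbitrarily large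
finite sets, all of whose `s`-element subsets have the same colour. -/
theorem exists_homogeneous_finset {κ : Type*} [Finite κ] (c : Finset ℕ → κ) (s m : ℕ) :
    ∃ T : Finset ℕ, T.card = m ∧ ∃ k, ∀ S ⊆ T, S.card = s → c S = k := by
  let U := Filter.hyperfilter ℕ
  choose lim hlim using fun f : ℕ → κ => U.exists_eventually_eq f
  -- `d j S` is the colour that `S` acquires after `j` further points, each generic for `U`, are
  -- added.
  let d : ℕ → Finset ℕ → κ := fun j =>
    Nat.rec c (fun _ d S => lim fun x => d (insert x S)) j
  have hd : ∀ j S, ∀ᶠ x in (U : Filter ℕ), d j (insert x S) = d (j + 1) S :=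
    fun j S => hlim fun x => d j (insert x S)
  -- The induction has to control the limit colours of all smaller subsets too, so that a generic
  -- point can always be added.
  suffices h : ∃ T : Finset ℕ, T.card = m ∧ ∀ S ⊆ T, ∀ j, S.card + j = s → d j S = d s ∅ by
    obtain ⟨T, hT, h⟩ := h
    exact ⟨T, hT, d s ∅, fun S hS hs => h S hS 0 hs⟩
  induction m with
  | zero =>
    refine ⟨∅, rfl, fun S hS j hj => ?_⟩
    obtain rfl := Finset.subset_empty.1 hS
    simp only [Finset.card_empty, zero_add] at hj
    rw [hj]
  | succ m ih =>
    obtain ⟨T, hT, h⟩ := ih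
    have h1 : ∀ᶠ x in (U : Filter ℕ), x ∉ T :=
      (Filter.hyperfilter_le_cofinite : (U : Filter ℕ) ≤ _) T.finite_toSet.compl_mem_cofinite
    have h2 : ∀ᶠ x in (U : Filter ℕ), ∀ S ∈ T.powerset, ∀ j ∈ Finset.range s,
        d j (insert x S) = d (j + 1) S :=
      (Filter.eventually_all_finset _).2 fun S _ =>
        (Filter.eventually_all_finset _).2 fun j _ => hd j S
    obtain ⟨x, hx, hxd⟩ := (h1.and h2).exists
    refine ⟨insert x T, by rw [Finset.card_insert_of_notMem hx, hT], fun S hS j hj => ?_⟩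
    by_cases hxS : x ∈ S
    · have hsub : S.erase x ⊆ T := by
        rw [← Finset.subset_insert_iff]; exact hS
      have hcard := Finset.card_erase_add_one hxS
      rw [← Finset.insert_erase hxS, hxd _ (Finset.mem_powerset.2 hsub) j
        (Finset.mem_range.2 (by omega))]
      exact h _ hsub (j + 1) (by omega)
    · exact h S ((Finset.subset_insert_iff_of_notMem hxS).1 hS) j hj

/-- Finite linear orders are rigid. This lets colourings of embeddings be read as colourings of
finite sets. -/
theorem relEmbedding_nat_eq_of_range_eq {A : Type*} {r : A → A → Prop} [IsStrictTotalOrder A r]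
    [Finite A] {f g : r ↪r ((· < ·) : ℕ → ℕ → Prop)} (h : Set.range f = Set.range g) : f = g := by
  classical
  let := linearOrderOfSTO r
  have : WellFoundedLT A := Finite.to_wellFoundedLT
  have hf : StrictMono f := fun a b hab => f.map_rel_iff.2 hab
  have hg : StrictMono g := fun a b hab => g.map_rel_iff.2 hab
  exact DFunLike.coe_injective ((StrictMono.range_inj hf hg).1 h)

/-- **Ramsey's theorem** for colourings of the embeddings of a finite linear order into `ℕ`. -/
theorem exists_homogeneous_relEmbedding {A : Type u} {B : Type v} {κ : Type*}
    {rA : A → A → Prop} {rB : B → B → Prop} [IsStrictTotalOrder A rA] [IsStrictTotalOrder B rB] [Finite A] [Finite B] [Finite κ]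
    (c : rA ↪r ((· < ·) : ℕ → ℕ → Prop) → κ) :
    ∃ f : rB ↪r ((· < ·) : ℕ → ℕ → Prop), ∀ g h : rA ↪r rB, c (g.trans f) = c (h.trans f) := by
  classical
  have hB : ∀ T : Finset ℕ, T.card = Nat.card B →
      ∃ f : rB ↪r ((· < ·) : ℕ → ℕ → Prop), ∀ b, f b ∈ T := by
    intro T hT
    let := linearOrderOfSTO rB
    let := Fintype.ofFinite B
    have e : B ≃o T := (Fintype.orderIsoFinOfCardEq B Fintype.card_eq_nat_card).symm.trans
      (T.orderIsoOfFin hT)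
    exact ⟨⟨⟨fun b => (e b : ℕ), fun a b hab => e.injective (Subtype.ext hab)⟩,
      fun {a b} => e.lt_iff_lt (x := a) (y := b)⟩, fun b => (e b).2⟩
  rcases isEmpty_or_nonempty (rA ↪r rB) with hAB | ⟨⟨g₀⟩⟩
  · obtain ⟨f, -⟩ := hB (Finset.range (Nat.card B)) (Finset.card_range _)
    exact ⟨f, fun g => hAB.elim g⟩
  obtain ⟨f₀, -⟩ := hB (Finset.range (Nat.card B)) (Finset.card_range _)
  -- The default colour is never met below; `g₀` and `f₀` serve only to show that some colour
  -- exists.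
  let col : Finset ℕ → κ := fun S =>
    if h : ∃ e : rA ↪r ((· < ·) : ℕ → ℕ → Prop), Set.range e = S then c h.choose
    else c (g₀.trans f₀)
  obtain ⟨T, hT, k, hk⟩ := exists_homogeneous_finset col (Nat.card A) (Nat.card B)
  obtain ⟨f, hf⟩ := hB T hT
  have key : ∀ g : rA ↪r rB, c (g.trans f) = k := by
    intro g
    let := Fintype.ofFinite A
    let e := g.trans f
    have hS : Set.range e = (Finset.univ.image e : Finset ℕ) := by simp
    have hex : ∃ e' : rA ↪r ((· < ·) : ℕ → ℕ → Prop),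
        Set.range e' = (Finset.univ.image e : Finset ℕ) := ⟨e, hS⟩
    have h1 : col (Finset.univ.image e) = c e := by
      simp only [col, dif_pos hex]
      rw [relEmbedding_nat_eq_of_range_eq (hex.choose_spec.trans hS.symm)]
    rw [← hk (Finset.univ.image e), h1]
    · intro x hx
      obtain ⟨a, -, rfl⟩ := Finset.mem_image.1 hx
      exact hf _
    · rw [Finset.card_image_of_injective _ e.injective, Finset.card_univ,
        Fintype.card_eq_nat_card]
  exact ⟨f, fun g h => (key g).trans (key h).symm⟩

/-- Compactness for colourings: if every colouring with finitely many colours is constant on one of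
the finite sets `Y i`, then finitely many of the sets `Y i` suffice. -/
theorem exists_finset_of_forall_coloring {X ι κ : Type*} [Finite κ] (Y : ι → Set X)
    (hY : ∀ i, (Y i).Finite) (h : ∀ c : X → κ, ∃ i, ∀ x ∈ Y i, ∀ y ∈ Y i, c x = c y) :
    ∃ J : Finset ι, ∀ c : X → κ, ∃ i ∈ J, ∀ x ∈ Y i, ∀ y ∈ Y i, c x = c y := by
  let : TopologicalSpace κ := ⊥
  have : DiscreteTopology κ := ⟨rfl⟩
  -- Being constant on `Y i` is a condition on finitely many coordinates, hence open in the product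
  -- topology; these sets cover the compact space of all colourings.
  have hopen : ∀ i, IsOpen {c : X → κ | ∀ x ∈ Y i, ∀ y ∈ Y i, c x = c y} := by
    intro i
    have : {c : X → κ | ∀ x ∈ Y i, ∀ y ∈ Y i, c x = c y} =
        ⋂ x ∈ Y i, ⋂ y ∈ Y i, {c : X → κ | c x = c y} := by
      ext c; simp
    rw [this]
    refine (hY i).isOpen_biInter fun x _ => (hY i).isOpen_biInter fun y _ => ?_
    have hxy : Continuous fun c : X → κ => (c x, c y) :=
      (continuous_apply x).prodMk (continuous_apply y)
    exact (isOpen_discrete {p : κ × κ | p.1 = p.2}).preimage hxy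
  obtain ⟨J, hJ⟩ := isCompact_univ.elim_finite_subcover _ hopen
    fun c _ => Set.mem_iUnion.2 (h c)
  refine ⟨J, fun c => ?_⟩
  obtain ⟨i, hi, hc⟩ := Set.mem_iUnion₂.1 (hJ (Set.mem_univ c))
  exact ⟨i, hi, hc⟩

/-! ### The partite construction for ordered binary relations -/

/-- A finite set with a map to `ℕ` and a binary relation, which matters only between points with
different images. -/
structure PartiteSystem where
  carrier : Type v
  part : carrier → ℕ
  rel : carrier → carrier → Prop
  [fin : Finite carrier]

namespace PartiteSystem

attribute [instance] fin

/-- The maps preserving the parts, and the relation between increasing parts. -/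
structure Hom (P Q : PartiteSystem.{v}) where
  toFun : P.carrier → Q.carrier
  part_eq : ∀ x, Q.part (toFun x) = P.part x
  rel_iff : ∀ x y, P.part x < P.part y → (Q.rel (toFun x) (toFun y) ↔ P.rel x y)

variable {A : Type v} (r E : A → A → Prop)

/-- The transversal copies of the ordered binary relation `(A, r, E)` over `e`. -/
structure Copy (e : A → ℕ) (P : PartiteSystem.{v}) where
  toFun : A → P.carrier
  part_eq : ∀ a, P.part (toFun a) = e a
  rel_iff : ∀ a b, r a b → (P.rel (toFun a) (toFun b) ↔ E a b)

variable {r E}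

theorem Copy.ext' {e : A → ℕ} {P : PartiteSystem.{v}} {g h : Copy r E e P}
    (H : ∀ a, g.toFun a = h.toFun a) : g = h := by
  cases g; cases h
  congr
  exact funext H

instance [Finite A] (e : A → ℕ) (P : PartiteSystem.{v}) : Finite (Copy r E e P) :=
  Finite.of_injective (fun g => g.toFun) fun _ _ h => Copy.ext' (congrFun h)

/-- The image of a copy. -/
def Copy.map {e : A → ℕ} {P Q : PartiteSystem.{v}} (g : Copy r E e P) (f : Hom P Q)
    (he : ∀ a b, r a b → e a < e b) : Copy r E e Q where
  toFun a := f.toFun (g.toFun a)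
  part_eq a := (f.part_eq _).trans (g.part_eq a)
  rel_iff a b hab := (f.rel_iff _ _ (by rw [g.part_eq, g.part_eq]; exact he a b hab)).trans
    (g.rel_iff a b hab)

/-- Composition of maps of partite systems. -/
def Hom.comp {P Q S : PartiteSystem.{v}} (g : Hom Q S) (f : Hom P Q) : Hom P S where
  toFun x := g.toFun (f.toFun x)
  part_eq x := (g.part_eq _).trans (f.part_eq x)
  rel_iff x y hxy := (g.rel_iff _ _ (by rw [f.part_eq, f.part_eq]; exact hxy)).trans
    (f.rel_iff x y hxy)

variable (E)

/-- The system obtained from `P` by replacing the parts of a transversal copy of `A` by words of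
length `ι`. -/
def power [Finite A] (e : A → ℕ) (P : PartiteSystem.{v}) (ι : Type) [Finite ι] :
    PartiteSystem.{v} where
  carrier := A × (ι → P.carrier) ⊕ ι × P.carrier
  part := Sum.elim (fun p => e p.1) fun p => P.part p.2
  rel
    -- The relation agrees with `E a a'` unless some coordinate disagrees. On a combinatorial line
    -- the fixed coordinates all agree with `E a a'`, so the active ones decide.
    | .inl (a, w), .inl (a', w') =>
      (E a a' ∧ ∀ i, P.rel (w i) (w' i)) ∨ (¬ E a a' ∧ ∃ i, P.rel (w i) (w' i))
    | .inl (_, w), .inr (i, x) => P.rel (w i) x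
    | .inr (i, x), .inl (_, w) => P.rel x (w i)
    | .inr (_, x), .inr (_, y) => P.rel x y

/-- The copy given by a word in the copies. -/
def powerCopy [Finite A] {e : A → ℕ} {P : PartiteSystem.{v}} {ι : Type} [Finite ι]
    (w : ι → Copy r E e P) : Copy r E e (power E e P ι) where
  toFun a := .inl (a, fun i => (w i).toFun a)
  part_eq _ := rfl
  rel_iff a b hab := by
    have h : ∀ i, P.rel ((w i).toFun a) ((w i).toFun b) ↔ E a b := fun i => (w i).rel_iff a b hab
    change (E a b ∧ ∀ i, P.rel ((w i).toFun a) ((w i).toFun b)) ∨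
      (¬ E a b ∧ ∃ i, P.rel ((w i).toFun a) ((w i).toFun b)) ↔ _
    simp only [h]
    by_cases hE : E a b <;> simp [hE]

variable {E}

open Classical in
/-- The map given by a combinatorial line. -/
noncomputable def lineMap {e : A → ℕ} {P : PartiteSystem.{v}} {ι : Type}
    (l : Combinatorics.Line (Copy r E e P) ι) (x : P.carrier) :
    A × (ι → P.carrier) ⊕ ι × P.carrier :=
  -- Over the part of `a`, active coordinates carry `x` and a fixed coordinate with value `g`
  -- carries the point of `g` at `a`. Points in other parts go to one chosen active coordinate,
  -- where their relations to words are read.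
  if h : ∃ a, e a = P.part x then
    Sum.inl (h.choose, fun i => (l.idxFun i).elim x fun g => g.toFun h.choose)
  else Sum.inr (l.proper.choose, x)

section lineMap

variable {e : A → ℕ} {P : PartiteSystem.{v}} {ι : Type}
  (l : Combinatorics.Line (Copy r E e P) ι) {x : P.carrier}

theorem lineMap_of_part_eq (he : Function.Injective e) {a : A} (h : e a = P.part x) :
    lineMap l x = Sum.inl (a, fun i => (l.idxFun i).elim x fun g => g.toFun a) := by
  have hex : ∃ a, e a = P.part x := ⟨a, h⟩
  have ha : hex.choose = a := he (hex.choose_spec.trans h.symm)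
  rw [lineMap, dif_pos hex, ha]

theorem lineMap_of_forall_part_ne (h : ¬ ∃ a, e a = P.part x) :
    lineMap l x = Sum.inr (l.proper.choose, x) := by
  rw [lineMap, dif_neg h]

end lineMap

/-- The map given by a combinatorial line, as a map of partite systems. -/
noncomputable def lineHom [Finite A] (e : r ↪r ((· < ·) : ℕ → ℕ → Prop)) {P : PartiteSystem.{v}}
    {ι : Type} [Finite ι] (l : Combinatorics.Line (Copy r E e P) ι) :
    Hom P (power E e P ι) where
  toFun := lineMap l
  part_eq x := by
    by_cases h : ∃ a, e a = P.part x
    · obtain ⟨a, h⟩ := h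
      rw [lineMap_of_part_eq l e.injective h]
      exact h
    · rw [lineMap_of_forall_part_ne l h]
      rfl
  rel_iff x y hxy := by
    have hl := l.proper.choose_spec
    by_cases hx : ∃ a, e a = P.part x <;> by_cases hy : ∃ a, e a = P.part y
    · obtain ⟨a, hx⟩ := hx
      obtain ⟨b, hy⟩ := hy
      rw [lineMap_of_part_eq l e.injective hx, lineMap_of_part_eq l e.injective hy]
      have hab : r a b := e.map_rel_iff.1 (by rw [hx, hy]; exact hxy)
      change (E a b ∧ ∀ i, P.rel _ _) ∨ (¬ E a b ∧ ∃ i, P.rel _ _) ↔ _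
      have h : ∀ i, P.rel ((l.idxFun i).elim x fun g => g.toFun a)
          ((l.idxFun i).elim y fun g => g.toFun b) ↔
            (l.idxFun i = none ∧ P.rel x y) ∨ (l.idxFun i ≠ none ∧ E a b) := by
        intro i
        cases l.idxFun i with
        | none => simp
        | some g => simpa using g.rel_iff a b hab
      simp only [h]
      by_cases hE : E a b
      · simp only [hE, not_true, false_and, or_false, true_and, and_true]
        exact ⟨fun H => by simpa [hl] using H l.proper.choose, fun H i => by
          by_cases hi : l.idxFun i = none <;> simp [hi, H]⟩
      · simp only [hE, not_false_eq_true, false_and, false_or, true_and, and_false, or_false]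
        exact ⟨fun ⟨_, H⟩ => H.2, fun H => ⟨_, hl, H⟩⟩
    · obtain ⟨a, hx⟩ := hx
      rw [lineMap_of_part_eq l e.injective hx, lineMap_of_forall_part_ne l hy]
      change P.rel (Option.elim _ _ _) y ↔ _
      rw [hl]; rfl
    · obtain ⟨b, hy⟩ := hy
      rw [lineMap_of_forall_part_ne l hx, lineMap_of_part_eq l e.injective hy]
      change P.rel x (Option.elim _ _ _) ↔ _
      rw [hl]; rfl
    · rw [lineMap_of_forall_part_ne l hx, lineMap_of_forall_part_ne l hy]
      exact Iff.rfl

/-- The partite lemma: the copies over a fixed `e` can be made monochromatic. -/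
theorem exists_hom_forall_copy_eq [Finite A] [IsStrictTotalOrder A r] {κ : Type*} [Finite κ]
    (e : r ↪r ((· < ·) : ℕ → ℕ → Prop)) (P : PartiteSystem.{v}) :
    ∃ Q : PartiteSystem.{v}, ∀ c : Copy r E e Q → κ, ∃ f : Hom P Q, ∀ g h : Copy r E e P,
      c (g.map f fun _ _ => e.map_rel_iff.2) = c (h.map f fun _ _ => e.map_rel_iff.2) := by
  obtain ⟨ι, _, hι⟩ := Combinatorics.Line.exists_mono_in_high_dimension (Copy r E e P) κ
  refine ⟨power E e P ι, fun c => ?_⟩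
  obtain ⟨l, k, hl⟩ := hι fun w => c (powerCopy E w)
  refine ⟨lineHom e l, ?_⟩
  have key : ∀ g : Copy r E e P,
      c (g.map (lineHom e l) fun _ _ => e.map_rel_iff.2) = k := by
    intro g
    -- The line map sends the copy `g` to the copy coded by the word that the line takes at `g`.
    rw [← hl g]
    congr 1
    refine Copy.ext' fun a => ?_
    refine (lineMap_of_part_eq l e.injective (g.part_eq a).symm).trans ?_
    refine congrArg Sum.inl (Prod.ext rfl (funext fun i => ?_))
    change (l.idxFun i).elim (g.toFun a) (fun g => g.toFun a) = ((l.idxFun i).getD g).toFun a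
    cases l.idxFun i <;> rfl
  exact fun g h => (key g).trans (key h).symm

/-- The copies over each of finitely many `e` can be made monochromatic simultaneously. -/
theorem exists_hom_forall_mem_copy_eq [Finite A] [IsStrictTotalOrder A r] {κ : Type*} [Finite κ]
    (S : Finset (r ↪r ((· < ·) : ℕ → ℕ → Prop))) (P : PartiteSystem.{v}) :
    ∃ Q : PartiteSystem.{v}, ∀ c : (∀ e : r ↪r ((· < ·) : ℕ → ℕ → Prop), Copy r E e Q → κ),
      ∃ f : Hom P Q, ∀ e ∈ S, ∀ g h : Copy r E e P,
        c e (g.map f fun _ _ => e.map_rel_iff.2) = c e (h.map f fun _ _ => e.map_rel_iff.2) := by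
  classical
  induction S using Finset.induction_on with
  | empty => exact ⟨P, fun c => ⟨⟨id, fun _ => rfl, fun _ _ _ => Iff.rfl⟩, by simp⟩⟩
  | insert e S _ ih =>
    obtain ⟨Q, hQ⟩ := ih
    obtain ⟨Q', hQ'⟩ := exists_hom_forall_copy_eq (E := E) (κ := κ) e Q
    refine ⟨Q', fun c => ?_⟩
    obtain ⟨f', hf'⟩ := hQ' (c e)
    -- The earlier members of `S` are treated for the colouring pulled back along `f'`. For the new
    -- `e`, all copies in `Q` already have one colour under `f'`, so precomposing with `f` does no
    -- harm.
    obtain ⟨f, hf⟩ := hQ fun e g => c e (g.map f' fun _ _ => e.map_rel_iff.2)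
    refine ⟨f'.comp f, fun e' he' g h => ?_⟩
    by_cases hee : e' = e
    · subst hee
      exact hf' (g.map f fun _ _ => e'.map_rel_iff.2) (h.map f fun _ _ => e'.map_rel_iff.2)
    · exact hf e' (Finset.mem_of_mem_insert_of_ne he' hee) g h

end PartiteSystem

/-! ### The Ramsey property in terms of embeddings -/

section Embeddings

variable {L : FirstOrder.Language.{u, v}}

/-- The copy of `A` given by an embedding. -/
def copyOf {A C : Type*} [L.Structure A] [L.Structure C] (f : A ↪[L] C) :
    Copies (L := L) C A :=
  ⟨f.toHom.range, ⟨f.equivRange⟩⟩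

theorem mem_copyOf {A C : Type*} [L.Structure A] [L.Structure C] (f : A ↪[L] C) (x : C) :
    x ∈ (copyOf f).1 ↔ ∃ a, f a = x := Iff.rfl

theorem exists_copyOf_eq {A C : Type*} [L.Structure A] [L.Structure C]
    (S : Copies (L := L) C A) : ∃ f : A ↪[L] C, copyOf f = S := by
  obtain ⟨S, ⟨e⟩⟩ := S
  refine ⟨S.subtype.comp e.toEmbedding, Subtype.ext (SetLike.ext fun x => ?_)⟩
  rw [mem_copyOf]
  constructor
  · rintro ⟨a, rfl⟩
    exact (e a).2
  · intro hx
    exact ⟨e.symm ⟨x, hx⟩, congrArg Subtype.val (e.apply_symm_apply ⟨x, hx⟩)⟩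

theorem finite_embedding {A B : Type*} [L.Structure A] [L.Structure B] [Finite A] [Finite B] :
    Finite (A ↪[L] B) :=
  Finite.of_injective (fun f => (f : A → B)) DFunLike.coe_injective

/-- The age of `M` has the Ramsey property if every colouring of the embeddings of `A` in `M` admits
an embedding of `B` in `M` on which it is constant. -/
theorem ramseyProperty_age_of_embeddings [L.IsRelational] {M : Type w} [L.Structure M]
    (H : ∀ k : ℕ, ∀ A ∈ L.age M, ∀ B ∈ L.age M, ∀ c : (A ↪[L] M) → Fin k,
      ∃ f : B ↪[L] M, ∀ g h : A ↪[L] B, c (f.comp g) = c (f.comp h)) :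
    RamseyProperty (L.age M) := by
  classical
  intro k A hA B hB
  rcases Nat.eq_zero_or_pos k with rfl | hk
  · exact ⟨B, hB, fun c => ⟨(copyOf (Embedding.refl L B)).1, (copyOf _).2, fun A₁ => (c A₁).elim0⟩⟩
  have hAf : Finite A := hA.1.finite
  have hBf : Finite B := hB.1.finite
  have := finite_embedding (L := L) (A := A) (B := B)
  obtain ⟨J, hJ⟩ := exists_finset_of_forall_coloring (κ := Fin k)
    (fun f : B ↪[L] M => Set.range fun g : A ↪[L] B => f.comp g)
    (fun f => Set.finite_range _) (fun c => by
      obtain ⟨f, hf⟩ := H k A hA B hB c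
      refine ⟨f, ?_⟩
      rintro _ ⟨g, rfl⟩ _ ⟨h, rfl⟩
      exact hf g h)
  -- The finitely many copies of `B` supplied by compactness span the required finite structure.
  let F : Set M := ⋃ f ∈ J, Set.range f
  have hF : F.Finite := J.finite_toSet.biUnion fun f _ => Set.finite_range f
  let C : L.Substructure M := Substructure.closure L F
  have hmem : ∀ x, x ∈ C ↔ x ∈ F := fun x => Substructure.mem_closure_iff_of_isRelational L F x
  have hCfin : Finite C := by
    have : (C : Set M) = F := Set.ext hmem
    exact (this ▸ hF : (C : Set M).Finite)
  refine ⟨⟨C, inferInstance⟩, ⟨Structure.FG.of_finite, ⟨C.subtype⟩⟩, fun c => ?_⟩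
  -- Embeddings leaving `C` get a dummy colour, which needs `0 < k`; those passing through a member
  -- of `J` stay inside `C`.
  obtain ⟨f, hfJ, hf⟩ := hJ fun e : A ↪[L] M =>
    if h : ∀ a, e a ∈ C then c (copyOf (e.codRestrict C h)) else ⟨0, hk⟩
  have hfC : ∀ b, f b ∈ C := fun b => (hmem _).2 (Set.mem_biUnion hfJ ⟨b, rfl⟩)
  let f' : B ↪[L] C := f.codRestrict C hfC
  refine ⟨(copyOf f').1, (copyOf f').2, ?_⟩
  have key : ∀ S : Copies (L := L) C A, S.1 ≤ (copyOf f').1 →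
      ∃ g : A ↪[L] B, copyOf (f'.comp g) = S := by
    intro S hS
    obtain ⟨e, rfl⟩ := exists_copyOf_eq S
    have he : ∀ a, ∃ b, f' b = e a := fun a => hS ((mem_copyOf e _).2 ⟨a, rfl⟩)
    let g : A ↪[L] B :=
      (f'.equivRange.symm.toEmbedding).comp (e.codRestrict f'.toHom.range he)
    refine ⟨g, congrArg copyOf (Embedding.ext fun a => ?_)⟩
    exact congrArg Subtype.val (f'.equivRange.apply_symm_apply ⟨e a, he a⟩)
  intro A₁ A₂ h₁ h₂
  obtain ⟨g₁, rfl⟩ := key A₁ h₁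
  obtain ⟨g₂, rfl⟩ := key A₂ h₂
  have h := hf (f.comp g₁) ⟨g₁, rfl⟩ (f.comp g₂) ⟨g₂, rfl⟩
  rw [dif_pos (show ∀ a, (f.comp g₁) a ∈ C from fun a => hfC (g₁ a)),
    dif_pos (show ∀ a, (f.comp g₂) a ∈ C from fun a => hfC (g₂ a))] at h
  exact h

/-- The arrow relation for colourings of embeddings, if the copies of `A` in `C` correspond to the
embeddings. -/
theorem Arrow.exists_embedding {A B C : Type*} [L.Structure A] [L.Structure B] [L.Structure C]
    {k : ℕ} (hC : Arrow L C B A k) (hrigid : ∀ e e' : A ↪[L] C, Set.range e = Set.range e' → e = e')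
    (c : (A ↪[L] C) → Fin k) :
    ∃ f : B ↪[L] C, ∀ g h : A ↪[L] B, c (f.comp g) = c (f.comp h) := by
  choose emb hemb using fun S : Copies (L := L) C A => exists_copyOf_eq S
  obtain ⟨B', hB', h⟩ := hC fun S => c (emb S)
  obtain ⟨f, hf⟩ := exists_copyOf_eq ⟨B', hB'⟩
  have hfB : (copyOf f).1 = B' := congrArg Subtype.val hf
  have hec : ∀ e : A ↪[L] C, emb (copyOf e) = e := fun e =>
    hrigid _ _ (congrArg (fun S : Copies (L := L) C A => (S.1 : Set C)) (hemb (copyOf e)))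
  have hle : ∀ g : A ↪[L] B, (copyOf (f.comp g)).1 ≤ B' := by
    rintro g _ ⟨a, rfl⟩
    rw [← hfB]
    exact ⟨g a, rfl⟩
  refine ⟨f, fun g g' => ?_⟩
  have := h _ _ (hle g) (hle g')
  rwa [hec, hec] at this

end Embeddings

/-! ### Structures with a linear order -/

section Star

variable {R : ℕ → Type u}

theorem edge_map {A : Type v} {M : Type w} [(starLang R).Structure A] [(starLang R).Structure M]
    (f : A ↪[starLang R] M) (a b : A) : edge R (f a) (f b) ↔ edge R a b := by
  have := f.map_rel (StarRel.edge : StarRel R 2) ![a, b]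
  rwa [show f ∘ ![a, b] = ![f a, f b] from List.ofFn_inj.1 (by simp)] at this

theorem less_map {A : Type v} {M : Type w} [(starLang R).Structure A] [(starLang R).Structure M]
    (f : A ↪[starLang R] M) (a b : A) : less R (f a) (f b) ↔ less R a b := by
  have := f.map_rel (StarRel.lt : StarRel R 2) ![a, b]
  rwa [show f ∘ ![a, b] = ![f a, f b] from List.ofFn_inj.1 (by simp)] at this

theorem relMap_edge {M : Type v} [(starLang R).Structure M] (p : Fin 2 → M) :
    RelMap (L := starLang R) (StarRel.edge : StarRel R 2) p ↔ edge R (p 0) (p 1) := by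
  rw [edge, show ![p 0, p 1] = p from List.ofFn_inj.1 (by simp)]

theorem relMap_lt {M : Type v} [(starLang R).Structure M] (p : Fin 2 → M) :
    RelMap (L := starLang R) (StarRel.lt : StarRel R 2) p ↔ less R (p 0) (p 1) := by
  rw [less, show ![p 0, p 1] = p from List.ofFn_inj.1 (by simp)]

/-- An embedding, as an embedding of the orders. -/
def lessEmbedding {A : Type v} {M : Type w} [(starLang R).Structure A] [(starLang R).Structure M]
    (f : A ↪[starLang R] M) : less R (T := A) ↪r less R (T := M) :=
  ⟨f.toEmbedding, fun {a b} => less_map f a b⟩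

theorem isStrictTotalOrder_less {A : Type v} {M : Type w} [(starLang R).Structure A]
    [(starLang R).Structure M] (f : A ↪[starLang R] M)
    (h : IsStrictTotalOrder M (less R (T := M))) : IsStrictTotalOrder A (less R (T := A)) :=
  (lessEmbedding f).isStrictTotalOrder

/-- An embedding of finite linear orders is determined by its range. -/
theorem embedding_eq_of_range_eq {A : Type v} {M : Type w} [(starLang R).Structure A] [Finite A]
    [(starLang R).Structure M] (hM : IsStrictTotalOrder M (less R (T := M)))
    {f g : A ↪[starLang R] M} (h : Set.range f = Set.range g) : f = g := by
  classical
  have := isStrictTotalOrder_less f hM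
  let := linearOrderOfSTO (less R (T := A))
  let := linearOrderOfSTO (less R (T := M))
  have : WellFoundedLT A := Finite.to_wellFoundedLT
  have hf : StrictMono f := fun a b hab => (less_map f a b).2 hab
  have hg : StrictMono g := fun a b hab => (less_map g a b).2 hab
  exact DFunLike.coe_injective ((StrictMono.range_inj hf hg).1 h)

end Star

/-! ### Structures determined by a linear order and a partition -/

section Labelled

variable {R : ℕ → Type u} {M : Type v} {N : Type w} [(starLang R).Structure M]
  [(starLang R).Structure N] {Λ : Type*}

/-- A map between ordered structures preserving all relations is an embedding. -/
def embeddingOfMapRel (hM : IsStrictTotalOrder M (less R (T := M)))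
    (hN : IsStrictTotalOrder N (less R (T := N))) (f : M → N)
    (hf : ∀ {n} (r : (starLang R).Relations n) (p : Fin n → M), RelMap r (f ∘ p) ↔ RelMap r p) :
    M ↪[starLang R] N where
  toFun := f
  inj' a b hab := by
    have h : ∀ x y, less R (f x) (f y) ↔ less R x y := fun x y => by
      have := hf (StarRel.lt : StarRel R 2) ![x, y]
      rwa [show f ∘ ![x, y] = ![f x, f y] from List.ofFn_inj.1 (by simp)] at this
    refine hM.trichotomous a b (fun hlt => ?_) (fun hlt => ?_)
    · exact hN.irrefl _ (hab ▸ (h a b).2 hlt)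
    · exact hN.irrefl _ (hab ▸ (h b a).2 hlt)
  map_fun' := fun {_} f => f.elim
  map_rel' := hf

/-- The embedding sending a point with position `u` and label `l` to `ν u l`. -/
def labelEmbedding {A : Type*} [(starLang R).Structure A]
    (hN : IsStrictTotalOrder N (less R (T := N))) (lam : N → Λ) (ν : ℕ → Λ → N)
    (hν : ∀ {n} (r : (starLang R).Relations n) (p : Fin n → N) (u : Fin n → ℕ),
      (∀ i j, u i < u j ↔ less R (p i) (p j)) →
        (RelMap r (fun i => ν (u i) (lam (p i))) ↔ RelMap r p))
    (e : A ↪[starLang R] N) (u : less R (T := A) ↪r ((· < ·) : ℕ → ℕ → Prop)) :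
    A ↪[starLang R] N :=
  embeddingOfMapRel (isStrictTotalOrder_less e hN) hN (fun a => ν (u a) (lam (e a)))
    fun r p => (hν r (fun i => e (p i)) (fun i => u (p i)) fun i j => by
      rw [less_map]; exact u.map_rel_iff).trans (e.map_rel r p)

/-- The point `ν u l` has label `l` and position `u`. Since labels are determined by the unary
relations, the label of a point of `A` is the same for every embedding. Hence restricting the
embedding of `B` with positions `f` along `g` gives the embedding of `A` with positions `f ∘ g`, and
Ramsey's theorem for linear orders applies. -/
theorem ramseyProperty_age_of_label (e : M ≃[starLang R] N)
    (hN : IsStrictTotalOrder N (less R (T := N))) (lam : N → Λ)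
    (hlam : ∀ x y : N, (∀ r : (starLang R).Relations 1,
      RelMap r (fun _ => x) ↔ RelMap r (fun _ => y)) → lam x = lam y) (ν : ℕ → Λ → N)
    (hν : ∀ {n} (r : (starLang R).Relations n) (p : Fin n → N) (u : Fin n → ℕ),
      (∀ i j, u i < u j ↔ less R (p i) (p j)) →
        (RelMap r (fun i => ν (u i) (lam (p i))) ↔ RelMap r p)) :
    RamseyProperty ((starLang R).age M) := by
  refine ramseyProperty_age_of_embeddings fun k A hA B hB c => ?_
  have := hA.1.finite
  have := hB.1.finite
  obtain ⟨eA⟩ := hA.2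
  obtain ⟨eB⟩ := hB.2
  let eA' := e.toEmbedding.comp eA
  let eB' := e.toEmbedding.comp eB
  have := isStrictTotalOrder_less eA' hN
  have := isStrictTotalOrder_less eB' hN
  obtain ⟨f, hf⟩ := exists_homogeneous_relEmbedding (rA := less R (T := A))
    (rB := less R (T := B))
    fun u => c (e.symm.toEmbedding.comp (labelEmbedding hN lam ν hν eA' u))
  refine ⟨e.symm.toEmbedding.comp (labelEmbedding hN lam ν hν eB' f), fun g h => ?_⟩
  have key : ∀ g : A ↪[starLang R] B,
      (e.symm.toEmbedding.comp (labelEmbedding hN lam ν hν eB' f)).comp g =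
        e.symm.toEmbedding.comp (labelEmbedding hN lam ν hν eA' ((lessEmbedding g).trans f)) := by
    intro g
    refine Embedding.ext fun a => congrArg e.symm (congrArg (ν (f (g a))) (hlam _ _ fun r => ?_))
    exact ((eB'.map_rel r fun _ => g a).trans (g.map_rel r fun _ => a)).trans
      (eA'.map_rel r fun _ => a).symm
  rw [key, key]
  exact hf _ _

end Labelled

/-! ### The blow-up of the `3`-cycle -/

/-- The label is the part. Density provides an increasing sequence in each part to serve as
positions; between different parts the order is decided by the labels alone. -/
theorem ramseyProperty_c3BlowUp (lt : Fin 3 × ℕ → Fin 3 × ℕ → Prop)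
    (hlt : IsStrictTotalOrder (Fin 3 × ℕ) lt)
    (hdense : ∀ i a b, lt (i, a) (i, b) → ∃ c, lt (i, a) (i, c) ∧ lt (i, c) (i, b))
    (hparts : ∀ i j a b, i < j → lt (i, a) (j, b)) :
    RamseyProperty ((starLang (UnarySymbol (Fin 3))).age (C3BlowUp lt)) := by
  have hseq : ∀ i, ∃ f : ℕ → ℕ, ∀ m n, m < n → lt (i, f m) (i, f n) := by
    intro i
    obtain ⟨x, y, hxy⟩ : ∃ x y, lt (i, x) (i, y) := by
      by_contra! h
      exact absurd (hlt.trichotomous (i, 0) (i, 1) (h 0 1) (h 1 0)) (by simp)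
    -- Repeatedly choosing a point between the current one and `y` gives an increasing sequence that
    -- stays below `y`.
    choose! g hg using fun a => hdense i a y
    let f : ℕ → ℕ := fun n => g^[n] x
    have hf : ∀ n, lt (i, f n) (i, y) := by
      intro n
      induction n with
      | zero => exact hxy
      | succ n ih =>
        simp only [f, Function.iterate_succ_apply'] at ih ⊢
        exact (hg _ ih).2
    have hstep : ∀ n, lt (i, f n) (i, f (n + 1)) := fun n => by
      have := (hg _ (hf n)).1
      simpa only [f, Function.iterate_succ_apply'] using this
    refine ⟨f, fun m n hmn => ?_⟩
    induction hmn with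
    | refl => exact hstep m
    | step _ ih => exact hlt.trans _ _ _ ih (hstep _)
  choose ν hν using hseq
  have hN : IsStrictTotalOrder (C3BlowUp lt) (less (UnarySymbol (Fin 3)) (T := C3BlowUp lt)) :=
    hlt
  have hfst : ∀ x y : Fin 3 × ℕ, lt x y → x.1 ≤ y.1 := fun x y h => by
    by_contra! h'
    exact hlt.irrefl _ (hlt.trans _ _ _ h (hparts _ _ _ _ h'))
  refine ramseyProperty_age_of_label (FirstOrder.Language.Equiv.refl _ (C3BlowUp lt)) hN
    (fun x => x.1)
    (fun x y h => ((h (.other (.mk x.1))).1 rfl).symm) (fun n i => (i, ν i n)) ?_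
  rintro n (_ | _ | ⟨⟨i⟩⟩) p u hu
  · exact Iff.rfl
  · have hu' : ∀ i j, u i < u j ↔ lt (p i) (p j) := hu
    change lt ((p 0).1, ν (p 0).1 (u 0)) ((p 1).1, ν (p 1).1 (u 1)) ↔ lt (p 0) (p 1)
    rcases lt_trichotomy (p 0).1 (p 1).1 with h | h | h
    · exact iff_of_true (hparts _ _ _ _ h) (hparts _ _ _ _ h)
    · rw [← hu', h]
      refine ⟨fun H => ?_, hν _ _ _⟩
      by_contra h'
      rcases (not_lt.1 h').eq_or_lt with h' | h'
      · exact hlt.irrefl _ (h' ▸ H)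
      · exact hlt.irrefl _ (hlt.trans _ _ _ H (hν _ _ _ h'))
    · exact iff_of_false (fun H => absurd (hfst _ _ H) (not_le.2 h))
        fun H => absurd (hfst _ _ H) (not_le.2 h)
  · exact Iff.rfl

/-! ### The rationals -/

theorem isStrictTotalOrder_less_rat : IsStrictTotalOrder ℚ (less NoSymbol (T := ℚ)) :=
  inferInstanceAs (IsStrictTotalOrder ℚ (· < ·))

theorem ramseyProperty_rat {T : Type v} [(starLang NoSymbol).Structure T]
    (e : T ≃[starLang NoSymbol] ℚ) : RamseyProperty ((starLang NoSymbol).age T) := by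
  refine ramseyProperty_age_of_label e isStrictTotalOrder_less_rat (fun _ => ())
    (fun _ _ _ => rfl) (fun n _ => (n : ℚ)) ?_
  rintro n (_ | _ | ⟨⟨⟩⟩) p u hu
  all_goals
    have hu' : ∀ i j, u i < u j ↔ p i < p j := hu
    exact Nat.cast_lt.trans (hu' 0 1)

/-! ### The dense local order -/

namespace S2

/-- An equality would make an odd multiple of `π` rational. Thus no two points at rational angles
are antipodal. -/
theorem exp_ratCast_ne_exp_add_pi (p q : ℚ) : Circle.exp p ≠ Circle.exp (q + Real.pi) := by
  intro h
  obtain ⟨m, hm⟩ := Circle.exp_eq_exp.1 h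
  have h1 : (1 + 2 * m : ℤ) ≠ 0 := by omega
  have h2 : ((1 + 2 * m : ℤ) : ℝ) ≠ 0 := Int.cast_ne_zero.2 h1
  refine irrational_pi ⟨(p - q) / (1 + 2 * m : ℤ), ?_⟩
  push_cast at h2 ⊢
  rw [div_eq_iff h2, hm]
  ring

theorem re_exp (x : ℝ) : (Circle.exp x : ℂ).re = Real.cos x := by
  rw [Circle.coe_exp, Complex.exp_ofReal_mul_I_re]

theorem re_ne_zero (z : S2) : (z.1 : ℂ).re ≠ 0 := by
  obtain ⟨_, q, rfl⟩ := z
  rw [re_exp, Ne, Real.cos_eq_zero_iff]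
  rintro ⟨k, hk⟩
  -- If `cos q = 0`, then `2 * q` is an odd multiple of `π`.
  refine exp_ratCast_ne_exp_add_pi (2 * q) 0 (Circle.exp_eq_exp.2 ⟨k, ?_⟩)
  push_cast
  rw [hk]
  ring

/-- The angle by which the half `i` is rotated from the right half. -/
noncomputable def shift (i : Fin 2) : ℝ := if i = 0 then Real.pi else 0

theorem exists_exp_add_shift (z : Circle) (hz : (z : ℂ).re ≠ 0) :
    ∃ (x : ℝ) (i : Fin 2), |x| < Real.pi / 2 ∧ z = Circle.exp (x + shift i) := by
  rcases lt_or_gt_of_ne hz with h | h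
  · refine ⟨Complex.arg (-z), 0, Complex.abs_arg_lt_pi_div_two_iff.2 (.inl (by simpa using h)), ?_⟩
    refine Circle.ext ?_
    have h1 := Complex.norm_mul_exp_arg_mul_I (-z : ℂ)
    rw [norm_neg, Circle.norm_coe, Complex.ofReal_one, one_mul] at h1
    rw [shift, if_pos rfl, Circle.coe_exp, Complex.ofReal_add, add_mul, Complex.exp_add,
      Complex.exp_pi_mul_I, h1]
    ring
  · refine ⟨Complex.arg z, 1, Complex.abs_arg_lt_pi_div_two_iff.2 (.inl h), ?_⟩
    rw [shift, if_neg (by decide), add_zero, Circle.exp_arg]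

theorem half_iff_eq {z : S2} {x : ℝ} {i : Fin 2} (hx : |x| < Real.pi / 2)
    (hz : z.1 = Circle.exp (x + shift i)) (j : Fin 2) : Half j z ↔ j = i := by
  have hcos : 0 < Real.cos x := Real.cos_pos_of_mem_Ioo (abs_lt.1 hx)
  have hre : (z.1 : ℂ).re = Real.cos (x + shift i) := by rw [hz, re_exp]
  fin_cases i <;> fin_cases j
  all_goals simp only [Half, hre, shift]
  all_goals simp [Real.cos_add_pi, hcos, hcos.le]

theorem exists_coordinate (z : S2) :
    ∃ p : ℝ × Fin 2, |p.1| < Real.pi / 2 ∧ z.1 = Circle.exp (p.1 + shift p.2) := by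
  obtain ⟨x, i, h⟩ := exists_exp_add_shift z.1 z.re_ne_zero
  exact ⟨(x, i), h⟩

/-- The angle of a point, with the left half rotated onto the right half. -/
noncomputable def angle (z : S2) : ℝ := (exists_coordinate z).choose.1

/-- The index of the half of a point. -/
noncomputable def side (z : S2) : Fin 2 := (exists_coordinate z).choose.2

theorem abs_angle_lt (z : S2) : |angle z| < Real.pi / 2 := (exists_coordinate z).choose_spec.1

theorem eq_exp (z : S2) : z.1 = Circle.exp (angle z + shift (side z)) :=
  (exists_coordinate z).choose_spec.2

theorem half_iff (i : Fin 2) (z : S2) : Half i z ↔ i = side z :=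
  half_iff_eq (abs_angle_lt z) (eq_exp z) i

theorem eq_of_exp_eq {x y : ℝ} (hx : |x| < Real.pi / 2) (hy : |y| < Real.pi / 2)
    (h : Circle.exp x = Circle.exp y) : x = y := by
  have hpi := Real.pi_pos
  refine Circle.invOn_arg_exp.1.injOn ?_ ?_ h
  all_goals
    rw [abs_lt] at hx hy
    constructor <;> linarith

theorem angle_side_eq {z : S2} {x : ℝ} {i : Fin 2} (hx : |x| < Real.pi / 2)
    (hz : z.1 = Circle.exp (x + shift i)) : angle z = x ∧ side z = i := by
  have hi : side z = i := (half_iff_eq hx hz _).1 ((half_iff _ z).2 rfl)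
  refine ⟨eq_of_exp_eq (abs_angle_lt z) hx ?_, hi⟩
  have := hz.symm.trans (eq_exp z)
  rw [hi, Circle.exp_add, Circle.exp_add] at this
  exact (mul_right_cancel this).symm

/-- Distinct points with the same angle would be antipodal, which rational angles exclude. -/
theorem angle_injective : Function.Injective angle := by
  have key : ∀ z w : S2, angle z = angle w → side z = 0 → side w = 1 → False := by
    intro z w h hz hw
    obtain ⟨p, hp⟩ := z.2
    obtain ⟨q, hq⟩ := w.2
    refine exp_ratCast_ne_exp_add_pi p q ?_
    rw [Circle.exp_add, ← hp, ← hq, eq_exp z, eq_exp w, hz, hw, h, ← Circle.exp_add, shift, shift,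
      if_pos rfl, if_neg (by decide), add_zero]
  intro z w h
  have hside : side z = side w := by
    by_contra hne
    rcases Fin.exists_fin_two.1 ⟨side z, rfl⟩ with hz | hz <;>
    rcases Fin.exists_fin_two.1 ⟨side w, rfl⟩ with hw | hw
    · exact hne (hz.trans hw.symm)
    · exact key z w h hz hw
    · exact key w z h.symm hw hz
    · exact hne (hz.trans hw.symm)
  exact Subtype.ext (by rw [eq_exp z, eq_exp w, h, hside])

theorem exists_exp_eq_exp_iff {x : ℝ} (hx : |x| < Real.pi) :
    (∃ θ ∈ Set.Ioo (0 : ℝ) Real.pi, Circle.exp x = Circle.exp θ) ↔ 0 < x := by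
  rw [abs_lt] at hx
  refine ⟨?_, fun h => ⟨x, ⟨h, hx.2⟩, rfl⟩⟩
  rintro ⟨θ, ⟨h0, h1⟩, h⟩
  have := Circle.invOn_arg_exp.1.injOn ⟨by linarith, by linarith⟩ ⟨by linarith, by linarith⟩ h
  linarith

theorem exists_exp_add_pi_eq_exp_iff {x : ℝ} (hx : |x| < Real.pi) :
    (∃ θ ∈ Set.Ioo (0 : ℝ) Real.pi, Circle.exp (x + Real.pi) = Circle.exp θ) ↔ x < 0 := by
  rw [abs_lt] at hx
  refine ⟨?_, fun h => ⟨x + Real.pi, ⟨by linarith, by linarith⟩, rfl⟩⟩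
  rintro ⟨θ, ⟨h0, h1⟩, h⟩
  by_contra! hx0
  have h' : Circle.exp x = Circle.exp (θ - Real.pi) := by
    rw [Circle.exp_sub, ← h, Circle.exp_add, mul_div_cancel_right]
  have := Circle.invOn_arg_exp.1.injOn ⟨by linarith, by linarith⟩ ⟨by linarith, by linarith⟩ h'
  linarith

/-- Rotating one endpoint by `π` reverses an edge, and the angles after rotation differ by less than
`π`. -/
theorem edge_iff (z w : S2) :
    Edge z w ↔ if side z = side w then angle z < angle w else angle w < angle z := by
  have hzw : |angle w - angle z| < Real.pi := by
    have h1 := abs_lt.1 (abs_angle_lt z)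
    have h2 := abs_lt.1 (abs_angle_lt w)
    exact abs_lt.2 ⟨by linarith, by linarith⟩
  have h : ∀ θ, w.1 = Circle.exp θ * z.1 ↔
      Circle.exp (angle w - angle z + (shift (side w) - shift (side z))) = Circle.exp θ := by
    intro θ
    rw [← div_eq_iff_eq_mul, eq_exp z, eq_exp w, ← Circle.exp_sub, add_sub_add_comm]
  simp only [Edge, h]
  split_ifs with hs
  · rw [hs, sub_self, add_zero, exists_exp_eq_exp_iff hzw, sub_pos]
  · have hexp : Circle.exp (angle w - angle z + (shift (side w) - shift (side z))) =
        Circle.exp (angle w - angle z + Real.pi) := by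
      rw [Circle.exp_add, Circle.exp_add]
      congr 1
      rcases Fin.exists_fin_two.1 ⟨side z, rfl⟩ with hz | hz <;>
      rcases Fin.exists_fin_two.1 ⟨side w, rfl⟩ with hw | hw
      · exact absurd (hz.trans hw.symm) hs
      · refine Circle.exp_eq_exp.2 ⟨-1, ?_⟩
        simp only [hz, hw, shift, if_true, one_ne_zero, if_false]
        push_cast
        ring
      · simp [hz, hw, shift]
      · exact absurd (hz.trans hw.symm) hs
    rw [hexp, exists_exp_add_pi_eq_exp_iff hzw, sub_neg]

/-- The reversal between different halves in the order cancels the reversal caused by the rotation.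
-/
theorem less_iff (z w : S2) : Less z w ↔ angle z < angle w := by
  have h : (∃ i, Half i z ∧ Half i w) ↔ side z = side w := by
    simp only [half_iff]
    exact ⟨fun ⟨_, h1, h2⟩ => h1 ▸ h2, fun h => ⟨_, rfl, h⟩⟩
  rw [Less, h, edge_iff, edge_iff]
  by_cases hs : side z = side w
  · simp [hs]
  · simp [hs, Ne.symm hs]

theorem exists_angle_mem_side_eq {a b : ℝ} (hab : a < b) (ha : -1 ≤ a) (hb : b ≤ 1) (i : Fin 2) :
    ∃ z : S2, angle z ∈ Set.Ioo a b ∧ side z = i := by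
  obtain ⟨q, h1, h2⟩ := exists_rat_btwn (add_lt_add_left hab (shift i))
  have hq : |(q : ℝ) - shift i| < Real.pi / 2 := by
    have := Real.pi_gt_three
    exact abs_lt.2 ⟨by linarith, by linarith⟩
  obtain ⟨hz, hs⟩ := angle_side_eq (z := ⟨Circle.exp q, q, rfl⟩) (i := i) hq
    (by rw [sub_add_cancel])
  exact ⟨_, by rw [hz]; exact ⟨by linarith, by linarith⟩, hs⟩

end S2

theorem isStrictTotalOrder_less_s2 :
    IsStrictTotalOrder S2 (less (UnarySymbol (Fin 2)) (T := S2)) :=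
  RelEmbedding.isStrictTotalOrder (s := ((· < ·) : ℝ → ℝ → Prop))
    ⟨⟨S2.angle, S2.angle_injective⟩, fun {z w} => (S2.less_iff z w).symm⟩

/-- Edges and order depend only on the order of the angles and on the halves, which act as labels.
Both halves are dense in angle, so position `n` can be realised in either half inside the `n`-th of
a sequence of disjoint increasing intervals. -/
theorem ramseyProperty_s2 {T : Type v} [(starLang (UnarySymbol (Fin 2))).Structure T]
    (e : T ≃[starLang (UnarySymbol (Fin 2))] S2) :
    RamseyProperty ((starLang (UnarySymbol (Fin 2))).age T) := by
  have hex : ∀ (n : ℕ) (i : Fin 2), ∃ z : S2,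
      S2.angle z ∈ Set.Ioo (-1 / (n + 1) : ℝ) (-1 / (n + 2)) ∧ S2.side z = i := by
    intro n i
    refine S2.exists_angle_mem_side_eq ?_ ?_ ?_ i
    · rw [div_lt_div_iff₀ (by positivity) (by positivity)]
      linarith
    · rw [le_div_iff₀ (by positivity)]
      have : (0 : ℝ) ≤ n := n.cast_nonneg
      linarith
    · rw [div_le_iff₀ (by positivity)]
      have : (0 : ℝ) ≤ n := n.cast_nonneg
      linarith
  choose ν hν hside using hex
  have hmono : ∀ m n i j, m < n → S2.angle (ν m i) < S2.angle (ν n j) := by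
    intro m n i j hmn
    refine ((hν m i).2.trans_le ?_).trans (hν n j).1
    rw [div_le_div_iff₀ (by positivity) (by positivity)]
    have : (m : ℝ) + 1 ≤ n := by exact_mod_cast hmn
    linarith
  have hlt : ∀ m n i j, (m = n → i = j) →
      (S2.angle (ν m i) < S2.angle (ν n j) ↔ m < n) := by
    intro m n i j hij
    refine ⟨fun h => ?_, hmono m n i j⟩
    by_contra! hle
    rcases hle.eq_or_lt with rfl | hlt
    · rw [hij rfl] at h
      exact lt_irrefl _ h
    · exact lt_asymm h (hmono _ _ _ _ hlt)
  refine ramseyProperty_age_of_label e isStrictTotalOrder_less_s2 S2.side (fun x y h => ?_) ν ?_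
  · exact (S2.half_iff _ _).1 ((h (.other (.mk (S2.side x)))).1 ((S2.half_iff _ x).2 rfl))
  · intro n r p u hu
    have hu' : ∀ i j, u i < u j ↔ S2.angle (p i) < S2.angle (p j) :=
      fun i j => (hu i j).trans (S2.less_iff _ _)
    have hpos : ∀ i j, S2.angle (ν (u i) (S2.side (p i))) < S2.angle (ν (u j) (S2.side (p j))) ↔
        S2.angle (p i) < S2.angle (p j) := by
      intro i j
      rw [hlt, hu']
      intro h
      -- Equal positions force equal angles, hence equal points and equal halves.
      rw [S2.angle_injective (le_antisymm
        (not_lt.1 fun H => h.symm.not_lt ((hu' _ _).2 H))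
        (not_lt.1 fun H => h.not_lt ((hu' _ _).2 H)))]
    rcases r with _ | _ | ⟨⟨i⟩⟩
    · change S2.Edge _ _ ↔ S2.Edge _ _
      simp only [S2.edge_iff, hside, hpos]
    · change S2.Less _ _ ↔ S2.Less _ _
      simp only [S2.less_iff, hpos]
    · change S2.Half i _ ↔ S2.Half i _
      simp only [S2.half_iff, hside]

/-! ### Ordered tournaments -/

namespace PartiteSystem

variable {A B : Type v} {rA EA : A → A → Prop} {rB EB : B → B → Prop}

/-- The restriction of a copy along an embedding. -/
def Copy.restrict {t : rB ↪r ((· < ·) : ℕ → ℕ → Prop)} {Q : PartiteSystem.{v}}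
    (b : Copy rB EB t Q) (g : rA ↪r rB) (hg : ∀ x y, rA x y → (EB (g x) (g y) ↔ EA x y)) :
    Copy rA EA (g.trans t) Q where
  toFun a := b.toFun (g a)
  part_eq a := b.part_eq (g a)
  rel_iff x y h := (b.rel_iff _ _ (g.map_rel_iff.2 h)).trans (hg x y h)

/-- The disjoint union of copies of `(B, EB)` over the members of `J`. -/
def sumCopies [Finite B] (EB : B → B → Prop) (J : Finset (rB ↪r ((· < ·) : ℕ → ℕ → Prop))) :
    PartiteSystem.{v} where
  carrier := J × B
  part p := p.1.1 p.2
  rel p q := p.1 = q.1 ∧ EB p.2 q.2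

/-- The copy of `(B, EB)` over a member of `J`. -/
def sumCopy [Finite B] {J : Finset (rB ↪r ((· < ·) : ℕ → ℕ → Prop))} {t} (ht : t ∈ J) :
    Copy rB EB t (sumCopies EB J) where
  toFun b := (⟨t, ht⟩, b)
  part_eq _ := rfl
  rel_iff _ _ _ := and_iff_right rfl

/-- The Ramsey theorem for finite ordered binary relations. -/
theorem exists_forall_copy_restrict_eq [Finite A] [Finite B] [IsStrictTotalOrder A rA]
    [IsStrictTotalOrder B rB] (EA : A → A → Prop) (EB : B → B → Prop) (κ : Type*) [Finite κ]
    [Nonempty κ] :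
    ∃ Q : PartiteSystem.{v}, ∀ c : (∀ e : rA ↪r ((· < ·) : ℕ → ℕ → Prop), Copy rA EA e Q → κ),
      ∃ (t : rB ↪r ((· < ·) : ℕ → ℕ → Prop)) (b : Copy rB EB t Q),
        ∀ (g h : rA ↪r rB) (hg : ∀ x y, rA x y → (EB (g x) (g y) ↔ EA x y))
          (hh : ∀ x y, rA x y → (EB (h x) (h y) ↔ EA x y)),
          c _ (b.restrict g hg) = c _ (b.restrict h hh) := by
  classical
  have : Finite (rA ↪r rB) := Finite.of_injective (fun g => (g : A → B)) DFunLike.coe_injective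
  obtain ⟨J, hJ⟩ := exists_finset_of_forall_coloring (κ := κ)
    (fun t : rB ↪r ((· < ·) : ℕ → ℕ → Prop) => Set.range fun g : rA ↪r rB => g.trans t)
    (fun t => Set.finite_range _) (fun c => by
      obtain ⟨f, hf⟩ := exists_homogeneous_relEmbedding (rB := rB) c
      refine ⟨f, ?_⟩
      rintro _ ⟨g, rfl⟩ _ ⟨h, rfl⟩
      exact hf g h)
  have hS : (⋃ t ∈ J, Set.range fun g : rA ↪r rB => g.trans t).Finite :=
    J.finite_toSet.biUnion fun t _ => Set.finite_range _
  -- Only finitely many positions of `A` arise inside the positions of `B` in `J`, so finitely many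
  -- applications of the partite lemma suffice.
  obtain ⟨Q, hQ⟩ := exists_hom_forall_mem_copy_eq (E := EA) (κ := κ) hS.toFinset (sumCopies EB J)
  refine ⟨Q, fun c => ?_⟩
  obtain ⟨f, hf⟩ := hQ c
  -- For the positions in `hS`, the colour of a copy coming through `f` now depends on its position
  -- alone; `d` records it, and Ramsey's theorem is applied to `d`.
  let d : rA ↪r ((· < ·) : ℕ → ℕ → Prop) → κ := fun e =>
    if h : Nonempty (Copy rA EA e (sumCopies EB J)) then
      c e (h.some.map f fun _ _ => e.map_rel_iff.2)
    else Classical.arbitrary κ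
  obtain ⟨t, ht, hd⟩ := hJ d
  refine ⟨t, (sumCopy ht).map f fun _ _ => t.map_rel_iff.2, fun g h hg hh => ?_⟩
  have key : ∀ (g : rA ↪r rB) (hg : ∀ x y, rA x y → (EB (g x) (g y) ↔ EA x y)),
      c _ (((sumCopy ht).map f fun _ _ => t.map_rel_iff.2).restrict g hg) = d (g.trans t) := by
    intro g hg
    have hne : Nonempty (Copy rA EA (g.trans t) (sumCopies EB J)) := ⟨(sumCopy ht).restrict g hg⟩
    have hmem : g.trans t ∈ hS.toFinset := hS.mem_toFinset.2 (Set.mem_biUnion ht ⟨g, rfl⟩)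
    simp only [d, dif_pos hne]
    exact hf _ hmem ((sumCopy ht).restrict g hg) hne.some
  rw [key, key]
  exact hd _ ⟨g, rfl⟩ _ ⟨h, rfl⟩

/-- The linear order on a partite system refining the order of the parts. -/
def lexLess (Q : PartiteSystem.{v}) (x y : Q.carrier) : Prop :=
  Q.part x < Q.part y ∨ Q.part x = Q.part y ∧ WellOrderingRel x y

theorem isStrictTotalOrder_lexLess (Q : PartiteSystem.{v}) :
    IsStrictTotalOrder Q.carrier Q.lexLess where
  trichotomous x y h1 h2 := by
    simp only [lexLess, not_or, not_and, not_lt] at h1 h2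
    have h := le_antisymm h2.1 h1.1
    exact trichotomous_of WellOrderingRel x y |>.resolve_left (h1.2 h)
      |>.resolve_right (h2.2 h.symm)
  irrefl x h := by
    rcases h with h | h
    · exact lt_irrefl _ h
    · exact irrefl_of WellOrderingRel x h.2
  trans x y z h1 h2 := by
    rcases h1 with h1 | h1 <;> rcases h2 with h2 | h2
    · exact .inl (h1.trans h2)
    · exact .inl (h1.trans_eq h2.1)
    · exact .inl (h1.1.trans_lt h2)
    · exact .inr ⟨h1.1.trans h2.1, trans_of WellOrderingRel h1.2 h2.2⟩

/-- The ordered tournament given by a partite system. -/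
instance (Q : PartiteSystem.{v}) : (starLang NoSymbol).Structure Q.carrier where
  funMap := fun f => f.elim
  RelMap := fun
    | StarRel.edge, p => (Q.lexLess (p 0) (p 1) ∧ Q.rel (p 0) (p 1)) ∨
        (Q.lexLess (p 1) (p 0) ∧ ¬ Q.rel (p 1) (p 0))
    | StarRel.lt, p => Q.lexLess (p 0) (p 1)

theorem mem_orderedTournaments (Q : PartiteSystem.{v}) :
    (⟨Q.carrier, inferInstance⟩ : Bundled (starLang NoSymbol).Structure) ∈
      orderedTournaments.{v} := by
  have hQ := Q.isStrictTotalOrder_lexLess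
  refine ⟨Q.fin, ⟨fun x y h => ?_, fun x y hxy => ?_⟩, hQ⟩
  · have hasymm : ∀ x y, Q.lexLess x y → ¬ Q.lexLess y x :=
      fun x y h h' => hQ.irrefl _ (hQ.trans _ _ _ h h')
    rintro (h' | h') <;> rcases h with h | h
    · exact hasymm _ _ h.1 h'.1
    · exact h.2 h'.2
    · exact h'.2 h.2
    · exact hasymm _ _ h.1 h'.1
  · change (Q.lexLess x y ∧ Q.rel x y ∨ Q.lexLess y x ∧ ¬ Q.rel y x) ∨
      (Q.lexLess y x ∧ Q.rel y x ∨ Q.lexLess x y ∧ ¬ Q.rel x y)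
    have : Q.lexLess x y ∨ Q.lexLess y x := by
      by_contra! h
      exact hxy (hQ.trichotomous x y h.1 h.2)
    tauto

/-- A copy of an ordered tournament is an embedding. -/
def Copy.toEmbedding [(starLang NoSymbol).Structure A]
    (hA : IsStrictTotalOrder A (less NoSymbol (T := A))) (hE : IsTournament (edge NoSymbol (T := A)))
    {e : less NoSymbol (T := A) ↪r ((· < ·) : ℕ → ℕ → Prop)} {Q : PartiteSystem.{v}}
    (g : Copy (less NoSymbol) (edge NoSymbol) e Q) : A ↪[starLang NoSymbol] Q.carrier :=
  have hless : ∀ x y, Q.lexLess (g.toFun x) (g.toFun y) ↔ less NoSymbol x y := by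
    intro x y
    rw [lexLess, g.part_eq, g.part_eq, e.map_rel_iff, or_iff_left_iff_imp]
    rintro ⟨h1, h2⟩
    rw [e.injective h1] at h2
    exact (irrefl_of WellOrderingRel _ h2).elim
  embeddingOfMapRel hA Q.isStrictTotalOrder_lexLess g.toFun (by
    rintro n (_ | _ | ⟨⟨⟩⟩) p
    · refine Iff.trans ?_ (relMap_edge p).symm
      change (Q.lexLess (g.toFun (p 0)) (g.toFun (p 1)) ∧ Q.rel (g.toFun (p 0)) (g.toFun (p 1))) ∨
        (Q.lexLess (g.toFun (p 1)) (g.toFun (p 0)) ∧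
          ¬ Q.rel (g.toFun (p 1)) (g.toFun (p 0))) ↔ _
      rw [hless, hless]
      generalize p 0 = x
      generalize p 1 = y
      have h1 := g.rel_iff x y
      have h2 := g.rel_iff y x
      have h3 := hE.1 x y
      have h4 : less NoSymbol x y → ¬ less NoSymbol y x :=
        fun h h' => hA.irrefl _ (hA.trans _ _ _ h h')
      by_cases hxy : x = y
      · subst hxy
        have := hA.irrefl x
        tauto
      · have h5 := hE.2 x y hxy
        have h6 : less NoSymbol x y ∨ less NoSymbol y x := by
          by_contra! h
          exact hxy (hA.trichotomous x y h.1 h.2)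
        tauto
    · exact (hless _ _).trans (relMap_lt p).symm)

end PartiteSystem

/-- The partite system that works for `A` and `B` becomes a finite ordered tournament, hence embeds
in `T`, and the colouring is pulled back along this embedding. -/
theorem ramseyProperty_of_age_eq_orderedTournaments {T : Type v} [(starLang NoSymbol).Structure T]
    (hT : (starLang NoSymbol).age T = orderedTournaments) :
    RamseyProperty ((starLang NoSymbol).age T) := by
  refine ramseyProperty_age_of_embeddings fun k A hA B hB c => ?_
  obtain ⟨iA⟩ := hA.2
  have : Nonempty (Fin k) := ⟨c iA⟩
  rw [hT] at hA hB
  obtain ⟨_, hAE, hA⟩ := hA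
  obtain ⟨_, hBE, hB⟩ := hB
  obtain ⟨Q, hQ⟩ := PartiteSystem.exists_forall_copy_restrict_eq (rA := less NoSymbol (T := A))
    (rB := less NoSymbol (T := B)) (edge NoSymbol) (edge NoSymbol) (Fin k)
  obtain ⟨i⟩ := (hT ▸ Q.mem_orderedTournaments : _ ∈ (starLang NoSymbol).age T).2
  obtain ⟨t, b, hb⟩ := hQ fun e g => c (i.comp (g.toEmbedding hA hAE))
  exact ⟨i.comp (b.toEmbedding hB hBE), fun g h =>
    hb (lessEmbedding g) (lessEmbedding h) (fun x y _ => edge_map g x y)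
      (fun x y _ => edge_map h x y)⟩

/-! ### The transfer to blow-ups -/

section BlowUp

variable {R : ℕ → Type u} {T : Type v} [(starLang R).Structure T] {prec : ℕ → ℕ → Prop}

theorem isStrictTotalOrder_less_blowUp (hT : IsStrictTotalOrder T (less R (T := T)))
    (hprec : IsStrictTotalOrder ℕ prec) :
    IsStrictTotalOrder (BlowUp T prec) (less R (T := BlowUp T prec)) := by
  have h : ∀ x y : BlowUp T prec, less R x y ↔ less R x.1 y.1 ∨ x.1 = y.1 ∧ prec x.2 y.2 :=
    fun _ _ => Iff.rfl
  refine
    { trichotomous := fun x y h1 h2 => ?_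
      irrefl := fun x hx => ?_
      trans := fun x y z h1 h2 => ?_ }
  · simp only [h, not_or, not_and] at h1 h2
    have h12 := hT.trichotomous _ _ h1.1 h2.1
    exact Prod.ext h12 (hprec.trichotomous _ _ (h1.2 h12) (h2.2 h12.symm))
  · rcases (h x x).1 hx with hx | hx
    · exact hT.irrefl _ hx
    · exact hprec.irrefl _ hx.2
  · rw [h] at h1 h2 ⊢
    rcases h1 with h1 | h1 <;> rcases h2 with h2 | h2
    · exact .inl (hT.trans _ _ _ h1 h2)
    · exact .inl (h2.1 ▸ h1)
    · exact .inl (h1.1 ▸ h2)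
    · exact .inr ⟨h1.1.trans h2.1, hprec.trans _ _ _ h1.2 h2.2⟩

variable {A : Type*} {B : Type*} [(starLang R).Structure A] [(starLang R).Structure B]
  (eA : A ↪[starLang R] BlowUp T prec) (eB : B ↪[starLang R] BlowUp T prec)

/-- The projection to `T` of a substructure of the blow-up. -/
def projection : (starLang R).Substructure T := Substructure.closure _ (Set.range fun a => (eA a).1)

theorem mem_projection (x : T) : x ∈ projection eA ↔ ∃ a, (eA a).1 = x :=
  Substructure.mem_closure_iff_of_isRelational _ _ _

/-- The projection map. -/
def toProjection (a : A) : projection eA := ⟨(eA a).1, (mem_projection eA _).2 ⟨a, rfl⟩⟩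

theorem toProjection_surjective : Function.Surjective (toProjection eA) := fun x => by
  obtain ⟨a, ha⟩ := (mem_projection eA _).1 x.2
  exact ⟨a, Subtype.ext ha⟩

theorem less_iff_projection (a b : A) :
    less R a b ↔ less R (eA a).1 (eA b).1 ∨ (eA a).1 = (eA b).1 ∧ prec (eA a).2 (eA b).2 :=
  (less_map eA a b).symm

theorem edge_iff_projection (a b : A) : edge R a b ↔ edge R (eA a).1 (eA b).1 :=
  (edge_map eA a b).symm

variable {eA eB}

/-- In a tournament two points coincide iff no edge joins them, and edges of the blow-up see only
first coordinates. So lying in one fibre is expressed by `E` and preserved by embeddings. -/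
theorem projection_eq_iff (hE : IsTournament (edge R (T := T))) (g : A ↪[starLang R] B) (a b : A) :
    (eB (g a)).1 = (eB (g b)).1 ↔ (eA a).1 = (eA b).1 := by
  have h : ∀ x y : T, x = y ↔ ¬ edge R x y ∧ ¬ edge R y x := fun x y => by
    refine ⟨?_, fun h => ?_⟩
    · rintro rfl
      exact ⟨fun h => hE.1 _ _ h h, fun h => hE.1 _ _ h h⟩
    · by_contra hxy
      exact (hE.2 x y hxy).elim h.1 h.2
  rw [h, h, ← edge_iff_projection, ← edge_iff_projection, ← edge_iff_projection,
    ← edge_iff_projection, edge_map, edge_map]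

theorem less_projection_iff (hT : IsStrictTotalOrder T (less R (T := T))) (a b : A) :
    less R (eA a).1 (eA b).1 ↔ less R a b ∧ (eA a).1 ≠ (eA b).1 := by
  rw [less_iff_projection eA]
  refine ⟨fun h => ⟨.inl h, fun hab => ?_⟩, fun ⟨h, hab⟩ => h.resolve_right fun h => hab h.1⟩
  rw [hab] at h
  exact hT.irrefl _ h

/-- Every symbol but `<` is read off first coordinates; on the projections, `<` is recovered from
`<` upstairs and the fibres. -/
theorem relMap_projection_iff (hE : IsTournament (edge R (T := T)))
    (hT : IsStrictTotalOrder T (less R (T := T))) (g : A ↪[starLang R] B) {n : ℕ}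
    (r : (starLang R).Relations n) (p : Fin n → A) :
    RelMap r (fun i => (eB (g (p i))).1) ↔ RelMap r (fun i => (eA (p i)).1) := by
  rcases r with _ | _ | r
  · rw [relMap_edge, relMap_edge, ← edge_iff_projection, ← edge_iff_projection, edge_map]
  · rw [relMap_lt, relMap_lt, less_projection_iff hT, less_projection_iff hT, less_map, Ne, Ne,
      projection_eq_iff hE]
  · exact ((eB.map_rel _ fun i => g (p i)).trans (g.map_rel _ p)).trans
      (eA.map_rel (StarRel.other r) p).symm

/-- The embedding of projections induced by an embedding. -/
noncomputable def projectionMap (hE : IsTournament (edge R (T := T)))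
    (hT : IsStrictTotalOrder T (less R (T := T))) (g : A ↪[starLang R] B) :
    projection eA ↪[starLang R] projection eB :=
  embeddingOfMapRel (isStrictTotalOrder_less (projection eA).subtype hT)
    (isStrictTotalOrder_less (projection eB).subtype hT)
    (fun x => toProjection eB (g (toProjection_surjective eA x).choose)) fun r p => by
      have h : ∀ i, (eA (toProjection_surjective eA (p i)).choose).1 = p i := fun i =>
        congrArg Subtype.val (toProjection_surjective eA (p i)).choose_spec
      refine (relMap_projection_iff (eA := eA) hE hT g r
        fun i => (toProjection_surjective eA (p i)).choose).trans ?_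
      rw [funext h]
      exact ((projection eA).subtype.map_rel r p)

theorem projectionMap_toProjection (hE : IsTournament (edge R (T := T)))
    (hT : IsStrictTotalOrder T (less R (T := T))) (g : A ↪[starLang R] B) (a : A) :
    projectionMap hE hT g (toProjection eA a) = toProjection eB (g a) :=
  Subtype.ext ((projection_eq_iff (eA := eA) (eB := eB) hE g _ _).2
    (congrArg Subtype.val (toProjection_surjective eA (toProjection eA a)).choose_spec))

/-- The embedding in the blow-up given by an embedding of the projection and second coordinates. -/
def blowUpEmbedding (hT : IsStrictTotalOrder T (less R (T := T)))
    (hprec : IsStrictTotalOrder ℕ prec) (ν : ((· < ·) : ℕ → ℕ → Prop) ↪r prec)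
    (eA : A ↪[starLang R] BlowUp T prec) (γ : projection eA ↪[starLang R] T)
    (u : less R (T := A) ↪r ((· < ·) : ℕ → ℕ → Prop)) : A ↪[starLang R] BlowUp T prec :=
  embeddingOfMapRel (isStrictTotalOrder_less eA (isStrictTotalOrder_less_blowUp hT hprec))
    (isStrictTotalOrder_less_blowUp hT hprec) (fun a => (γ (toProjection eA a), ν (u a))) (by
      have hrel : ∀ {n} (r : (starLang R).Relations n) (p : Fin n → A),
          RelMap r (fun i => γ (toProjection eA (p i))) ↔ RelMap r (fun i => (eA (p i)).1) :=
        fun r p => (γ.map_rel r fun i => toProjection eA (p i)).trans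
          ((projection eA).subtype.map_rel r fun i => toProjection eA (p i)).symm
      rintro n (_ | _ | r) p
      · exact (relMap_edge (M := T) fun i => γ (toProjection eA (p i))).symm.trans
          ((hrel .edge p).trans ((relMap_edge _).trans
            ((edge_iff_projection eA (p 0) (p 1)).symm.trans (relMap_edge p).symm)))
      · have hlt := ((relMap_lt (M := T) fun i => γ (toProjection eA (p i))).symm.trans
          (hrel .lt p)).trans (relMap_lt _)
        refine Iff.trans ?_ ((less_iff_projection eA _ _).symm.trans (relMap_lt p).symm)
        refine or_congr hlt ?_
        have heq : γ (toProjection eA (p 0)) = γ (toProjection eA (p 1)) ↔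
            (eA (p 0)).1 = (eA (p 1)).1 := γ.injective.eq_iff.trans Subtype.ext_iff
        refine (and_congr_left' heq).trans (and_congr_right fun h => ?_)
        refine ν.map_rel_iff.trans (u.map_rel_iff.trans ((less_iff_projection eA _ _).trans ?_))
        rw [h]
        exact (or_iff_right (hT.irrefl _)).trans (and_iff_right rfl)
      · exact (hrel _ p).trans (eA.map_rel (StarRel.other r) p))

end BlowUp

theorem ramseyProperty_blowUp {R : ℕ → Type u} {T : Type v} [(starLang R).Structure T]
    (hE : IsTournament (edge R (T := T))) (hT : IsStrictTotalOrder T (less R (T := T)))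
    (hR : RamseyProperty ((starLang R).age T)) {prec : ℕ → ℕ → Prop}
    (e : prec ≃r ((· < ·) : ℚ → ℚ → Prop)) :
    RamseyProperty ((starLang R).age (BlowUp T prec)) := by
  have hprec : IsStrictTotalOrder ℕ prec := e.toRelEmbedding.isStrictTotalOrder
  have hbl := isStrictTotalOrder_less_blowUp (R := R) hT hprec
  let ν : ((· < ·) : ℕ → ℕ → Prop) ↪r prec :=
    (⟨⟨fun n => (n : ℚ), Nat.cast_injective⟩, Nat.cast_lt⟩ :
      ((· < ·) : ℕ → ℕ → Prop) ↪r ((· < ·) : ℚ → ℚ → Prop)).trans e.symm.toRelEmbedding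
  refine ramseyProperty_age_of_embeddings fun k A hA B hB c => ?_
  have := hA.1.finite
  have := hB.1.finite
  obtain ⟨eA⟩ := hA.2
  obtain ⟨eB⟩ := hB.2
  have := isStrictTotalOrder_less eA hbl
  have := isStrictTotalOrder_less eB hbl
  have hfA : Finite (projection eA) := Finite.of_surjective _ (toProjection_surjective eA)
  have hfB : Finite (projection eB) := Finite.of_surjective _ (toProjection_surjective eB)
  obtain ⟨C, hC, harr⟩ := hR k ⟨projection eA, inferInstance⟩
    ⟨Structure.FG.of_finite, ⟨(projection eA).subtype⟩⟩ ⟨projection eB, inferInstance⟩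
    ⟨Structure.FG.of_finite, ⟨(projection eB).subtype⟩⟩
  have := hC.1.finite
  obtain ⟨τ⟩ := hC.2
  have : Finite (projection eA ↪[starLang R] C) := finite_embedding
  -- The colour of `u` is the whole function of `γ`; there are finitely many such functions because
  -- `C` is finite.
  obtain ⟨f, hf⟩ := exists_homogeneous_relEmbedding (rA := less R (T := A)) (rB := less R (T := B))
    fun u => fun γ : projection eA ↪[starLang R] C =>
      c (blowUpEmbedding hT hprec ν eA (τ.comp γ) u)
  -- The colour no longer depends on `g`, which leaves a colouring `d` of embeddings of the
  -- projection; if `A` does not embed in `B`, any `d` will do.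
  have hcol : ∃ d : (projection eA ↪[starLang R] C) → Fin k, ∀ (g : A ↪[starLang R] B) γ,
      c (blowUpEmbedding hT hprec ν eA (τ.comp γ) ((lessEmbedding g).trans f)) = d γ := by
    rcases isEmpty_or_nonempty (A ↪[starLang R] B) with h | ⟨⟨g₀⟩⟩
    · obtain ⟨u, -⟩ := exists_homogeneous_relEmbedding (rA := less R (T := A))
        (rB := less R (T := A)) fun _ => ()
      exact ⟨fun γ => c (blowUpEmbedding hT hprec ν eA (τ.comp γ) u), fun g => h.elim g⟩
    · exact ⟨_, fun g γ => congrFun (hf (lessEmbedding g) (lessEmbedding g₀)) γ⟩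
  obtain ⟨d, hd⟩ := hcol
  obtain ⟨φ, hφ⟩ := harr.exists_embedding
    (fun _ _ => embedding_eq_of_range_eq (isStrictTotalOrder_less τ hT)) d
  refine ⟨blowUpEmbedding hT hprec ν eB (τ.comp φ) f, fun g h => ?_⟩
  have key : ∀ g : A ↪[starLang R] B,
      c ((blowUpEmbedding hT hprec ν eB (τ.comp φ) f).comp g) =
        d (φ.comp (projectionMap hE hT g)) := by
    intro g
    rw [← hd g]
    congr 1
    -- The second coordinates agree by definition, both being `ν (f (g a))`.
    refine Embedding.ext fun a => Prod.ext ?_ rfl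
    exact congrArg (fun x => τ (φ x)) (projectionMap_toProjection hE hT g a).symm
  rw [key, key]
  exact hφ _ _

/-! ### The standard expansions -/

/-- Each axiom concerns at most three points, and these lie in a finite substructure, which belongs
to the age. -/
theorem isStrictTotalOrder_less_of_age_eq {T : Type v} [(starLang NoSymbol).Structure T]
    (hT : (starLang NoSymbol).age T = orderedTournaments) :
    IsStrictTotalOrder T (less NoSymbol (T := T)) := by
  have key : ∀ s : Finset T, ∃ S : (starLang NoSymbol).Substructure T, (∀ x ∈ s, x ∈ S) ∧
      IsStrictTotalOrder S (less NoSymbol (T := S)) := by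
    intro s
    let S : (starLang NoSymbol).Substructure T := Substructure.closure _ (s : Set T)
    have hmem : ∀ x, x ∈ S ↔ x ∈ s := fun x => Substructure.mem_closure_iff_of_isRelational _ _ _
    have hfin : Finite S := by
      have : (S : Set T) = s := Set.ext hmem
      exact (this ▸ s.finite_toSet : (S : Set T).Finite)
    have hS : (⟨S, inferInstance⟩ : Bundled (starLang NoSymbol).Structure) ∈
        (starLang NoSymbol).age T :=
      ⟨Structure.FG.of_finite, ⟨S.subtype⟩⟩
    rw [hT] at hS
    exact ⟨S, fun x hx => (hmem x).2 hx, hS.2.2⟩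
  classical
  refine
    { trichotomous := fun x y h1 h2 => ?_
      irrefl := fun x hx => ?_
      trans := fun x y z h1 h2 => ?_ }
  · obtain ⟨S, hs, hS⟩ := key {x, y}
    have := hS.trichotomous ⟨x, hs x (by simp)⟩ ⟨y, hs y (by simp)⟩
      (fun h => h1 ((less_map S.subtype _ _).2 h)) (fun h => h2 ((less_map S.subtype _ _).2 h))
    exact congrArg Subtype.val this
  · obtain ⟨S, hs, hS⟩ := key {x}
    exact hS.irrefl ⟨x, hs x (by simp)⟩ ((less_map S.subtype _ _).1 hx)
  · obtain ⟨S, hs, hS⟩ := key {x, y, z}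
    exact (less_map S.subtype ⟨x, _⟩ ⟨z, _⟩).2 (hS.trans _ ⟨y, hs y (by simp)⟩ _
      ((less_map S.subtype ⟨x, hs x (by simp)⟩ _).1 h1)
      ((less_map S.subtype _ ⟨z, hs z (by simp)⟩).1 h2))

theorem IsStandardExpansion.isStrictTotalOrder_and_ramseyProperty {R : ℕ → Type} {T : Type v}
    {s : (starLang R).Structure T} (h : IsStandardExpansion R T s) :
    IsStrictTotalOrder T (less R (T := T)) ∧ RamseyProperty ((starLang R).age T) := by
  cases h with
  | rat _ h =>
    obtain ⟨e⟩ := h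
    exact ⟨isStrictTotalOrder_less e.toEmbedding isStrictTotalOrder_less_rat, ramseyProperty_rat e⟩
  | denseLocal _ h =>
    obtain ⟨e⟩ := h
    exact ⟨isStrictTotalOrder_less e.toEmbedding isStrictTotalOrder_less_s2, ramseyProperty_s2 e⟩
  | generic _ h =>
    exact ⟨isStrictTotalOrder_less_of_age_eq h.age,
      ramseyProperty_of_age_eq_orderedTournaments h.age⟩

theorem edge_eq_digraphEdge {R : ℕ → Type u} {T : Type v} [digraphLang.Structure T]
    [(starLang R).Structure T] (h : (digraphIncl R).IsExpansionOn T) :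
    edge R (T := T) = digraphEdge :=
  funext fun x => funext fun y => h.map_onRelation DigraphRel.edge ![x, y]

end RamseyBlowUp

theorem mainTheorem10 :
    -- the infinite homogeneous tournaments with their standard expansions
    (∀ (T : Type v) [RamseyBlowUp.digraphLang.Structure T] [Countable T] [Infinite T],
      RamseyBlowUp.IsTournament (RamseyBlowUp.digraphEdge (T := T)) →
      RamseyBlowUp.digraphLang.IsUltrahomogeneous T →
      ∀ (R : ℕ → Type) [s : (RamseyBlowUp.starLang R).Structure T],
        (RamseyBlowUp.digraphIncl R).IsExpansionOn T →
        RamseyBlowUp.IsStandardExpansion R T s →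
        ∀ prec : ℕ → ℕ → Prop, Nonempty (prec ≃r ((· < ·) : ℚ → ℚ → Prop)) →
          RamseyBlowUp.RamseyProperty
            ((RamseyBlowUp.starLang R).age (RamseyBlowUp.BlowUp T prec))) ∧
    -- transfer, for an arbitrary linearly ordered relational expansion of a tournament
    (∀ (R : ℕ → Type u) (T : Type v) [(RamseyBlowUp.starLang R).Structure T],
      RamseyBlowUp.IsTournament (RamseyBlowUp.edge R (T := T)) →
      IsStrictTotalOrder T (RamseyBlowUp.less R (T := T)) →
      RamseyBlowUp.RamseyProperty ((RamseyBlowUp.starLang R).age T) →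
      ∀ prec : ℕ → ℕ → Prop, Nonempty (prec ≃r ((· < ·) : ℚ → ℚ → Prop)) →
        RamseyBlowUp.RamseyProperty
          ((RamseyBlowUp.starLang R).age (RamseyBlowUp.BlowUp T prec))) ∧
    -- the `3`-cycle, with the fibres named by unary predicates
    (∀ lt : Fin 3 × ℕ → Fin 3 × ℕ → Prop, IsStrictTotalOrder (Fin 3 × ℕ) lt →
      (∀ i a b, lt (i, a) (i, b) → ∃ c, lt (i, a) (i, c) ∧ lt (i, c) (i, b)) →
      (∀ i j a b, i < j → lt (i, a) (j, b)) →
      RamseyBlowUp.RamseyProperty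
        ((RamseyBlowUp.starLang (RamseyBlowUp.UnarySymbol (Fin 3))).age
          (RamseyBlowUp.C3BlowUp lt))) := by
  refine ⟨fun T _ _ _ hE _ R s hexp hstd prec ⟨e⟩ => ?_, fun R T _ hE hT hR prec ⟨e⟩ => ?_, ?_⟩
  · rw [← RamseyBlowUp.edge_eq_digraphEdge hexp] at hE
    obtain ⟨hT, hR⟩ := hstd.isStrictTotalOrder_and_ramseyProperty
    exact RamseyBlowUp.ramseyProperty_blowUp hE hT hR e
  · exact RamseyBlowUp.ramseyProperty_blowUp hE hT hR e
  · exact RamseyBlowUp.ramseyProperty_c3BlowUp
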